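/- **Proposition 1.2.** There is an absolute constant $c$ such that the following holds. Let $\mathfrak{L}$ be a finite collection of $L$ (distinct) lines in $\mathbb{R}^3$. A point $x\in\mathbb{R}^3$ is a joint for $\mathfrak{L}$ if at least three lines of $\mathfrak{L}$ whose directions span $\mathbb{R}^3$ pass through $x$; its multiplicity $N(x)$ is the number of unordered triples of lines of $\mathfrak{L}$ through $x$ whose directions span $\mathbb{R}^3$. For integers $N\ge 0$ and $k\ge 1$, let $J_N^k$ be the set of joints $x$ for $\mathfrak{L}$ such that $N\le N(x)<2N$ and $x$ lies on at least $k$ and fewer than $2k$ lines of $\mathfrak{L}$. Then $J_N^k$ is finite and $$|J_N^k|\cdot N^{1/2}\;\le\; c\left(\frac{L^{3/2}}{k^{1/2}}+\frac{L}{k}\,N^{1/2}\right).$$ The constant $c$ is independent of $\mathfrak{L}$, $N$ and $k$. -/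

import Mathlib

/-- Three-dimensional Euclidean space. -/
abbrev Space3 : Type := EuclideanSpace ℝ (Fin 3)

/-- A line in three-dimensional space: an affine subspace with one-dimensional direction.
(The empty affine subspace has direction `⊥`, so it is excluded.) -/
def IsLine (l : AffineSubspace ℝ Space3) : Prop :=
  Module.finrank ℝ l.direction = 1

/-- The directions of the lines in `T` together span the whole space. -/
def DirectionsSpan (T : Finset (AffineSubspace ℝ Space3)) : Prop :=
  (⨆ l ∈ T, l.direction) = ⊤

/-- `x` is a joint for the collection `A` of lines: there are at least three lines in `A`
passing through `x` whose directions span the space. -/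
def IsJoint (A : Finset (AffineSubspace ℝ Space3)) (x : Space3) : Prop :=
  ∃ T : Finset (AffineSubspace ℝ Space3),
    T ⊆ A ∧ 3 ≤ T.card ∧ (∀ l ∈ T, x ∈ l) ∧ DirectionsSpan T

/-- The (unordered) triples of lines of `A` through `x` whose directions span the space. -/
def spanningTriples (A : Finset (AffineSubspace ℝ Space3)) (x : Space3) :
    Set (Finset (AffineSubspace ℝ Space3)) :=
  {T | T ⊆ A ∧ T.card = 3 ∧ (∀ l ∈ T, x ∈ l) ∧ DirectionsSpan T}

/-- The multiplicity `N(x)`: the number of unordered triples of lines of `A` through `x`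
whose directions span the space. The set counted is finite, being contained in the
power set of the finite set `A`. -/
noncomputable def jointMultiplicity (A : Finset (AffineSubspace ℝ Space3)) (x : Space3) : ℕ :=
  (spanningTriples A x).ncard

/-- The number of lines of `A` passing through `x`. -/
noncomputable def linesThrough (A : Finset (AffineSubspace ℝ Space3)) (x : Space3) : ℕ :=
  {l | l ∈ A ∧ x ∈ l}.ncard

/-- The set `J_N^k`: the joints of `A` with multiplicity in `[N, 2N)` which lie on at least `k`
and fewer than `2k` lines of `A`. -/
def jointsNK (A : Finset (AffineSubspace ℝ Space3)) (N k : ℕ) : Set Space3 :=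
  {x | IsJoint A x ∧
    (N ≤ jointMultiplicity A x ∧ jointMultiplicity A x < 2 * N) ∧
    (k ≤ linesThrough A x ∧ linesThrough A x < 2 * k)}

/-! Let S be the number of points of `jointsNK A N k`. A polynomial of degree O(Q) cuts space into
cells, each with at most S/Q³ of these points, and a line meets O(Q) cells
(`exists_polynomial_partition`). A cell met by m lines and containing s points satisfies the
Szemerédi–Trotter bound s ≲ m²/k³ + m/k (`exists_card_rich_points_le`). If the first term dominates,
its geometric mean with s ≤ S/Q³ is linear in m, hence can be summed over the cells. The points off
the surface thus contribute either a term giving S ≲ L²/(Qk³), or QL/k ≲ k²QL/N, because N ≤ 8k³.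

The points on the surface are handled by the joints argument (`sum_card_spanningSubsets_le`). A
polynomial of least degree vanishing on them cannot vanish on every line, so some line carries few
of them. Deleting it destroys at most (2k)² spanning triples at each, and repeating over all lines
leaves O(k²QL/N) points.

Equating L²/(Qk³) with k²QL/N gives Q² = LN/k⁵ and S√N ≲ L^(3/2)/k^(1/2). If this Q is below 1,
Szemerédi–Trotter alone suffices, and its term L/k is the second term of the bound.
Szemerédi–Trotter itself follows the same scheme with a generic projection to the plane,
inclusion–exclusion doing the work inside the cells.

Partitioning iterates a polynomial ham sandwich theorem, which follows from the
Lusternik–Schnirelmann theorem. For the latter, take odd mod 2 functions constant on the sets of a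
forbidden cover: the cup product of their coboundaries evaluates to 1 on a hemisphere, yet vanishes
on every small simplex. -/

/-! ### Mod 2 cochains, prisms and cup products. -/

section Cochains

variable {E : Type*}

/-- The simplicial coboundary modulo two, on cochains of ordered simplices. -/
def coboundary : (List E → ZMod 2) → List E → ZMod 2
  | _, [] => 0
  | β, v :: l => β l + coboundary (fun m => β (v :: m)) l

/-- The dual of the prism operator between the maps `f` and `g`. -/
def prism (f g : E → E) : (List E → ZMod 2) → List E → ZMod 2
  | _, [] => 0
  | β, v :: l => β (f v :: g v :: l.map g) + prism f g (fun m => β (f v :: m)) l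

theorem zmod_two_add_self (a : ZMod 2) : a + a = 0 := CharTwo.add_self_eq_zero a

theorem coboundary_add (β γ : List E → ZMod 2) (l : List E) :
    coboundary (fun m => β m + γ m) l = coboundary β l + coboundary γ l := by
  induction l generalizing β γ with
  | nil => simp [coboundary]
  | cons v l ih => simp only [coboundary, ih]; ring

theorem prism_add (f g : E → E) (β γ : List E → ZMod 2) (l : List E) :
    prism f g (fun m => β m + γ m) l = prism f g β l + prism f g γ l := by
  induction l generalizing β γ with
  | nil => simp [prism]
  | cons v l ih => simp only [prism, ih]; ring

theorem coboundary_map (f : E → E) (β : List E → ZMod 2) (l : List E) :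
    coboundary (fun m => β (m.map f)) l = coboundary β (l.map f) := by
  induction l generalizing β with
  | nil => simp [coboundary]
  | cons v l ih =>
    simp only [coboundary, List.map_cons]
    rw [ih (fun m => β (f v :: m))]

/-- The prism operator is a chain homotopy between the maps induced by `f` and `g`. -/
theorem prism_coboundary (f g : E → E) (β : List E → ZMod 2) (l : List E) :
    prism f g (coboundary β) l =
      coboundary (prism f g β) l + (β (l.map f) + β (l.map g)) := by
  induction l generalizing β with
  | nil => simp [prism, coboundary, zmod_two_add_self]
  | cons v l ih =>
    have h1 := ih (fun m => β (f v :: m))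
    simp only [prism, coboundary, List.map_cons, coboundary_add, prism_add] at h1 ⊢
    rw [h1, coboundary_map g (fun m => β (f v :: g v :: m))]
    linear_combination zmod_two_add_self (β (f v :: l.map g))

/-- The cup product of the one-cochains `s i u + s i v`, the last vertices using `s 0`. -/
def cupProduct (s : ℕ → E → ZMod 2) : List E → ZMod 2
  | [] => 0
  | [_] => 1
  | u :: v :: l => (s l.length u + s l.length v) * cupProduct s (v :: l)

/-- The cup product multiplied by the value of the next zero-cochain at the first vertex. -/
def headCupProduct (s : ℕ → E → ZMod 2) : List E → ZMod 2
  | [] => 0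
  | v :: l => s l.length v * cupProduct s (v :: l)

/-- All faces of a simplex have the same length, so the factor pulls out. The truncated subtraction
matters only for `[]`, where both sides vanish. -/
theorem coboundary_mul_length (c : ℕ → ZMod 2) (β : List E → ZMod 2) (l : List E) :
    coboundary (fun m => c m.length * β m) l = c (l.length - 1) * coboundary β l := by
  induction l generalizing β c with
  | nil => simp [coboundary]
  | cons v l ih =>
    simp only [coboundary]
    have h := ih (fun k => c (k + 1)) (fun m => β (v :: m))
    simp only [List.length_cons] at h ⊢
    rw [h]
    cases l with
    | nil => simp [coboundary]
    | cons w l => simp; ring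

/-- This is the cocycle property of the cup product: the faces containing `v` sum to the face
opposite `v`. -/
theorem coboundary_cupProduct_cons (s : ℕ → E → ZMod 2) (v u : E) (l : List E) :
    coboundary (fun m => cupProduct s (v :: m)) (u :: l) = cupProduct s (u :: l) := by
  induction l generalizing v u with
  | nil => simp [coboundary, cupProduct]
  | cons x l ih =>
    have h : (fun m => cupProduct s (v :: u :: m)) =
        fun m : List E => (s m.length v + s m.length u) * cupProduct s (u :: m) := rfl
    rw [coboundary, h, coboundary_mul_length (fun k => s k v + s k u)
      (fun m => cupProduct s (u :: m)), ih]
    simp only [cupProduct, List.length_cons, Nat.add_sub_cancel]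
    linear_combination (zmod_two_add_self (s l.length v)) * cupProduct s (x :: l)

/-- A product of coboundaries is exact: replacing its leading factor by the zero-cochain gives a
primitive. -/
theorem coboundary_headCupProduct (s : ℕ → E → ZMod 2) (v u : E) (l : List E) :
    coboundary (headCupProduct s) (v :: u :: l) = cupProduct s (v :: u :: l) := by
  have h : (fun m => headCupProduct s (v :: m)) =
      fun m : List E => s m.length v * cupProduct s (v :: m) := rfl
  rw [coboundary, h, coboundary_mul_length (fun k => s k v) (fun m => cupProduct s (v :: m)),
    coboundary_cupProduct_cons]
  simp only [headCupProduct, cupProduct, List.length_cons, Nat.add_sub_cancel]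
  ring

theorem cupProduct_eq_zero (s : ℕ → E → ZMod 2) (i : ℕ) (l : List E) (hi : i + 1 < l.length)
    (h : ∀ u ∈ l, ∀ v ∈ l, s i u = s i v) : cupProduct s l = 0 := by
  induction l with
  | nil => simp [cupProduct]
  | cons u l ih =>
    cases l with
    | nil => simp at hi
    | cons v l =>
      rw [cupProduct]
      rcases eq_or_ne i l.length with rfl | hne
      · rw [h u (by simp) v (by simp), zmod_two_add_self, zero_mul]
      · rw [ih (by simp at hi ⊢; omega) fun a ha b hb =>
          h a (List.mem_cons_of_mem _ ha) b (List.mem_cons_of_mem _ hb), mul_zero]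

theorem cupProduct_map_neg [Neg E] (s : ℕ → E → ZMod 2) (l : List E)
    (hs : ∀ i, ∀ v ∈ l, s i (-v) = s i v + 1) :
    cupProduct s (l.map (fun v => -v)) = cupProduct s l := by
  induction l with
  | nil => simp [cupProduct]
  | cons u l ih =>
    cases l with
    | nil => simp [cupProduct]
    | cons v l =>
      have h := ih fun i a ha => hs i a (List.mem_cons_of_mem _ ha)
      simp only [List.map_cons] at h ⊢
      rw [cupProduct, cupProduct, h, hs _ u (by simp), hs _ v (by simp), List.length_map]
      linear_combination (zmod_two_add_self 1) * cupProduct s (v :: l)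

/-- The antipode fixes the cup product, as both terms of each factor change by 1, while the leading
zero-cochain changes by 1. -/
theorem headCupProduct_map_neg [Neg E] (s : ℕ → E → ZMod 2) (l : List E)
    (hs : ∀ i, ∀ v ∈ l, s i (-v) = s i v + 1) :
    headCupProduct s l + headCupProduct s (l.map (fun v => -v)) = cupProduct s l := by
  cases l with
  | nil => simp [cupProduct, headCupProduct]
  | cons v l =>
    have h := cupProduct_map_neg s (v :: l) hs
    simp only [List.map_cons] at h ⊢
    rw [headCupProduct, headCupProduct, h, hs _ v (by simp), List.length_map]
    linear_combination zmod_two_add_self (s l.length v * cupProduct s (v :: l))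

end Cochains

/-! ### Fundamental chains of hemispheres and their boundaries. -/

section Hemispheres

variable {E : Type*} [AddCommGroup E] [Module ℝ E]

/-- The contraction towards `a`, at time `s / n`. -/
noncomputable def contraction (a : E) (n s : ℕ) (v : E) : E :=
  (1 - (s / n : ℝ)) • v + (s / n : ℝ) • a

/-- Evaluation of cochains on a subdivided `k`-dimensional hemisphere with poles `e 0, …, e k`. -/
noncomputable def hemisphere (e : ℕ → E) (n : ℕ) : ℕ → (List E → ZMod 2) → ZMod 2
  | 0, β => β [e 0]
  -- The next hemisphere is the cone over the whole `k`-sphere with apex `e (k + 1)`, sliced into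
  -- `n` layers of prisms.
  | k + 1, β => ∑ s ∈ Finset.range n,
      (hemisphere e n k (prism (contraction (e (k + 1)) n s) (contraction (e (k + 1)) n (s + 1)) β)
        + hemisphere e n k (fun l =>
          prism (contraction (e (k + 1)) n s) (contraction (e (k + 1)) n (s + 1)) β
            (l.map (fun v => -v))))

/-- Evaluation of cochains on a subdivided `k`-dimensional sphere. -/
noncomputable def sphereEval (e : ℕ → E) (n k : ℕ) (β : List E → ZMod 2) : ZMod 2 :=
  hemisphere e n k β + hemisphere e n k (fun l => β (l.map (fun v => -v)))

theorem hemisphere_add (e : ℕ → E) (n k : ℕ) (β γ : List E → ZMod 2) :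
    hemisphere e n k (fun l => β l + γ l) = hemisphere e n k β + hemisphere e n k γ := by
  induction k generalizing β γ with
  | zero => rfl
  | succ k ih =>
    have h (f g : E → E) : prism f g (fun l => β l + γ l) =
      fun l => prism f g β l + prism f g γ l := funext (prism_add f g β γ)
    simp only [hemisphere, h, ih, ← Finset.sum_add_distrib]
    refine Finset.sum_congr rfl fun s _ => ?_
    ring

theorem sphereEval_add (e : ℕ → E) (n k : ℕ) (β γ : List E → ZMod 2) :
    sphereEval e n k (fun l => β l + γ l) = sphereEval e n k β + sphereEval e n k γ := by
  simp only [sphereEval, hemisphere_add]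
  ring

theorem sphereEval_map_neg (e : ℕ → E) (n k : ℕ) (β : List E → ZMod 2) :
    sphereEval e n k (fun l => β (l.map (fun v => -v))) = sphereEval e n k β := by
  simp only [sphereEval, List.map_map, Function.comp_def, neg_neg, List.map_id']
  ring

theorem hemisphere_succ (e : ℕ → E) (n k : ℕ) (β : List E → ZMod 2) :
    hemisphere e n (k + 1) β = ∑ s ∈ Finset.range n, sphereEval e n k
      (prism (contraction (e (k + 1)) n s) (contraction (e (k + 1)) n (s + 1)) β) := rfl

theorem contraction_zero (a : E) (n : ℕ) : contraction a n 0 = id := by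
  funext v; simp [contraction]

theorem contraction_self (a : E) {n : ℕ} (hn : n ≠ 0) : contraction a n n = fun _ => a := by
  funext v; simp [contraction, hn]

/-- At the apex both hemispheres collapse to the same degenerate simplices, which cancel modulo 2.
-/
theorem sphereEval_contraction_self (e : ℕ → E) {n : ℕ} (hn : n ≠ 0) (k : ℕ) (a : E)
    (β : List E → ZMod 2) : sphereEval e n k (fun l => β (l.map (contraction a n n))) = 0 := by
  simp only [sphereEval, contraction_self a hn, List.map_map, Function.comp_def,
    zmod_two_add_self]

/-- By the prism homotopy the layers telescope, leaving the sphere at time 0 and the collapsed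
sphere at time `n`. The hypothesis, that spheres are cycles, is established by induction together
with this formula. -/
theorem hemisphere_coboundary_of_sphereEval (e : ℕ → E) {n : ℕ} (hn : n ≠ 0) (k : ℕ)
    (h : ∀ γ, sphereEval e n k (coboundary γ) = 0) (β : List E → ZMod 2) :
    hemisphere e n (k + 1) (coboundary β) = sphereEval e n k β := by
  have key (s : ℕ) : sphereEval e n k (prism (contraction (e (k + 1)) n s)
      (contraction (e (k + 1)) n (s + 1)) (coboundary β)) =
      sphereEval e n k (fun l => β (l.map (contraction (e (k + 1)) n (s + 1)))) -
      sphereEval e n k (fun l => β (l.map (contraction (e (k + 1)) n s))) := by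
    rw [funext (prism_coboundary _ _ β), sphereEval_add, h, zero_add, sphereEval_add,
      CharTwo.sub_eq_add, add_comm]
  rw [hemisphere_succ, Finset.sum_congr rfl fun s _ => key s, Finset.sum_range_sub
    (fun s => sphereEval e n k (fun l => β (l.map (contraction (e (k + 1)) n s)))),
    sphereEval_contraction_self e hn, contraction_zero, CharTwo.sub_eq_add, zero_add]
  simp

theorem sphereEval_coboundary (e : ℕ → E) {n : ℕ} (hn : n ≠ 0) (k : ℕ) (β : List E → ZMod 2) :
    sphereEval e n k (coboundary β) = 0 := by
  induction k generalizing β with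
  | zero => simp [sphereEval, hemisphere, coboundary, zmod_two_add_self]
  | succ k ih =>
    have h : (fun l => coboundary β (l.map (fun v => -v))) =
        coboundary (fun l => β (l.map (fun v => -v))) :=
      funext fun l => (coboundary_map _ β l).symm
    rw [sphereEval, h, hemisphere_coboundary_of_sphereEval e hn k ih,
      hemisphere_coboundary_of_sphereEval e hn k ih, sphereEval_map_neg, zmod_two_add_self]

/-- The boundary of a hemisphere is the sphere of one dimension less. -/
theorem hemisphere_coboundary (e : ℕ → E) {n : ℕ} (hn : n ≠ 0) (k : ℕ) (β : List E → ZMod 2) :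
    hemisphere e n (k + 1) (coboundary β) = sphereEval e n k β :=
  hemisphere_coboundary_of_sphereEval e hn k (sphereEval_coboundary e hn k) β

end Hemispheres

/-! ### The Lusternik–Schnirelmann theorem. -/

section LusternikSchnirelmann

theorem prism_congr {E : Type*} (f g : E → E) (β γ : List E → ZMod 2) (l : List E)
    (h : ∀ m : List E, m.length = l.length + 1 → (∀ x ∈ m, ∃ v ∈ l, x = f v ∨ x = g v) →
      β m = γ m) : prism f g β l = prism f g γ l := by
  induction l generalizing β γ with
  | nil => rfl
  | cons v l ih =>
    simp only [prism]
    congr 1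
    · refine h _ (by simp) fun x hx => ?_
      simp only [List.mem_cons, List.mem_map] at hx
      rcases hx with rfl | rfl | ⟨w, hw, rfl⟩
      · exact ⟨v, by simp, Or.inl rfl⟩
      · exact ⟨v, by simp, Or.inr rfl⟩
      · exact ⟨w, by simp [hw], Or.inr rfl⟩
    · refine ih _ _ fun m hm hx => h _ (by simp [hm]) fun x hxm => ?_
      rcases List.mem_cons.1 hxm with rfl | hxm
      · exact ⟨v, by simp, Or.inl rfl⟩
      · obtain ⟨w, hw, hxw⟩ := hx x hxm
        exact ⟨w, by simp [hw], hxw⟩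

/-- The `k`-th standard basis vector. -/
def standardVector (M k : ℕ) : Fin (M + 1) → ℝ := fun i => if (i : ℕ) = k then 1 else 0

/-- The boundary of the `k + 1`-dimensional cross-polytope, spanned by `k + 1` basis vectors. -/
def crossSphere (M k : ℕ) : Set (Fin (M + 1) → ℝ) :=
  {v | ∑ i, |v i| = 1 ∧ ∀ i : Fin (M + 1), k < i → v i = 0}

theorem sum_standardVector {M k : ℕ} (hk : k ≤ M) : ∑ i, standardVector M k i = 1 := by
  have h (i : Fin (M + 1)) :
      standardVector M k i = if i = (⟨k, by omega⟩ : Fin (M + 1)) then 1 else 0 := by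
    simp [standardVector, Fin.ext_iff]
  simp [h]

/-- The apex has support disjoint from that of `v`, so the ℓ¹ norm stays 1 along the segment and no
normalization is needed. -/
theorem contraction_mem_crossSphere {M k n s : ℕ} (hk : k + 1 ≤ M) (hn : n ≠ 0) (hs : s ≤ n)
    {v : Fin (M + 1) → ℝ} (hv : v ∈ crossSphere M k) :
    contraction (standardVector M (k + 1)) n s v ∈ crossSphere M (k + 1) := by
  have hn' : (0 : ℝ) < n := by positivity
  have ht0 : (0 : ℝ) ≤ s / n := by positivity
  have ht1 : (s / n : ℝ) ≤ 1 := by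
    rw [div_le_one hn']; exact_mod_cast hs
  constructor
  · have h (i : Fin (M + 1)) : |contraction (standardVector M (k + 1)) n s v i| =
        (1 - (s / n : ℝ)) * |v i| + (s / n : ℝ) * standardVector M (k + 1) i := by
      simp only [contraction, Pi.add_apply, Pi.smul_apply, smul_eq_mul, standardVector]
      split_ifs with hi
      · rw [hv.2 i (by omega)]
        simp [abs_of_nonneg ht0]
      · simp [abs_mul, abs_of_nonneg (sub_nonneg.2 ht1)]
    simp only [h, Finset.sum_add_distrib, ← Finset.mul_sum, hv.1, sum_standardVector hk]
    ring
  · intro i hi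
    have : (i : ℕ) ≠ k + 1 := by omega
    simp [contraction, standardVector, hv.2 i (by omega), this]

theorem standardVector_mem_crossSphere (M : ℕ) : standardVector M 0 ∈ crossSphere M 0 := by
  constructor
  · rw [← sum_standardVector (Nat.zero_le M)]
    refine Finset.sum_congr rfl fun i _ => abs_of_nonneg ?_
    unfold standardVector
    split_ifs <;> simp
  · intro i hi
    simp only [standardVector]
    rw [if_neg (by omega)]

theorem neg_mem_crossSphere {M k : ℕ} {v : Fin (M + 1) → ℝ} (hv : v ∈ crossSphere M k) :
    -v ∈ crossSphere M k :=
  ⟨by simpa using hv.1, fun i hi => by simp [hv.2 i hi]⟩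

theorem norm_le_one_of_mem_crossSphere {M k : ℕ} {v : Fin (M + 1) → ℝ}
    (hv : v ∈ crossSphere M k) : ‖v‖ ≤ 1 := by
  refine (pi_norm_le_iff_of_nonneg zero_le_one).2 fun i => ?_
  rw [← hv.1, Real.norm_eq_abs]
  exact Finset.single_le_sum (f := fun i => |v i|) (fun i _ => abs_nonneg _) (Finset.mem_univ i)

theorem ne_zero_of_mem_crossSphere {M k : ℕ} {v : Fin (M + 1) → ℝ}
    (hv : v ∈ crossSphere M k) : v ≠ 0 := by
  rintro rfl
  simpa using hv.1

theorem norm_standardVector_le (M k : ℕ) : ‖standardVector M k‖ ≤ 1 := by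
  refine (pi_norm_le_iff_of_nonneg zero_le_one).2 fun i => ?_
  unfold standardVector
  split_ifs <;> simp

theorem dist_contraction_le {E : Type*} [NormedAddCommGroup E] [NormedSpace ℝ E] (a u v : E)
    {n s : ℕ} (hn : n ≠ 0) (hs : s ≤ n) :
    dist (contraction a n s u) (contraction a n s v) ≤ dist u v := by
  have hn' : (0 : ℝ) < n := by positivity
  have ht0 : (0 : ℝ) ≤ s / n := by positivity
  have ht1 : (s / n : ℝ) ≤ 1 := by
    rw [div_le_one hn']; exact_mod_cast hs
  rw [contraction, contraction, dist_add_right, dist_smul₀, Real.norm_eq_abs,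
    abs_of_nonneg (sub_nonneg.2 ht1)]
  nlinarith [dist_nonneg (x := u) (y := v)]

theorem dist_contraction_succ_le {E : Type*} [NormedAddCommGroup E] [NormedSpace ℝ E] (a v : E)
    {n : ℕ} (s : ℕ) (hn : n ≠ 0) (ha : ‖a‖ ≤ 1) (hv : ‖v‖ ≤ 1) :
    dist (contraction a n s v) (contraction a n (s + 1) v) ≤ 2 / n := by
  have hn' : (0 : ℝ) < n := by positivity
  have h : contraction a n s v - contraction a n (s + 1) v = (1 / n : ℝ) • (v - a) := by
    simp only [contraction, Nat.cast_add, Nat.cast_one]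
    module
  rw [dist_eq_norm, h, norm_smul, Real.norm_eq_abs, abs_of_pos (by positivity)]
  have := norm_sub_le v a
  rw [div_mul_eq_mul_div, one_mul]
  gcongr
  linarith

/-- The hemisphere consists of small simplices with vertices on the boundary of the
cross-polytope. -/
theorem hemisphere_congr {M n k : ℕ} (hn : n ≠ 0) (hk : k ≤ M)
    (β γ : List (Fin (M + 1) → ℝ) → ZMod 2)
    (h : ∀ l : List (Fin (M + 1) → ℝ), l.length = k + 1 → (∀ v ∈ l, v ∈ crossSphere M k) →
      (∀ u ∈ l, ∀ v ∈ l, dist u v ≤ 2 * k / n) → β l = γ l) :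
    hemisphere (standardVector M) n k β = hemisphere (standardVector M) n k γ := by
  induction k generalizing β γ with
  | zero =>
    exact h [standardVector M 0] rfl (by simpa using standardVector_mem_crossSphere M) (by simp)
  | succ k ih =>
    have key : ∀ s < n, ∀ l : List (Fin (M + 1) → ℝ), l.length = k + 1 →
        (∀ v ∈ l, v ∈ crossSphere M k) → (∀ u ∈ l, ∀ v ∈ l, dist u v ≤ 2 * k / n) →
        prism (contraction (standardVector M (k + 1)) n s)
          (contraction (standardVector M (k + 1)) n (s + 1)) β l =
        prism (contraction (standardVector M (k + 1)) n s)
          (contraction (standardVector M (k + 1)) n (s + 1)) γ l := by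
      intro s hs l hl hmem hdist
      refine prism_congr _ _ _ _ _ fun m hm hx => h m (by omega) ?_ ?_
      · intro x hxm
        obtain ⟨v, hv, rfl | rfl⟩ := hx x hxm
        · exact contraction_mem_crossSphere hk hn hs.le (hmem v hv)
        · exact contraction_mem_crossSphere hk hn hs (hmem v hv)
      -- Each further cone enlarges the diameter of simplices by at most one time step, which moves
      -- points by at most `2 / n`.
      · have hsplit : 2 * ((k + 1 : ℕ) : ℝ) / n = 2 * k / n + 2 / n := by
          push_cast; ring
        have hpos : (0 : ℝ) ≤ 2 / n := by positivity
        rw [hsplit]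
        have hstep (v) (hv : v ∈ l) := dist_contraction_succ_le (standardVector M (k + 1)) v s hn
          (norm_standardVector_le M _) (norm_le_one_of_mem_crossSphere (hmem v hv))
        intro x hxm y hym
        obtain ⟨u, hu, rfl | rfl⟩ := hx x hxm <;> obtain ⟨v, hv, rfl | rfl⟩ := hx y hym
        · linarith [dist_contraction_le (standardVector M (k + 1)) u v hn hs.le, hdist u hu v hv]
        · linarith [dist_contraction_le (standardVector M (k + 1)) u v hn hs.le, hdist u hu v hv,
            hstep v hv, dist_triangle (contraction (standardVector M (k + 1)) n s u)
              (contraction (standardVector M (k + 1)) n s v)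
              (contraction (standardVector M (k + 1)) n (s + 1) v)]
        · rw [dist_comm]
          linarith [dist_contraction_le (standardVector M (k + 1)) v u hn hs.le, hdist v hv u hu,
            hstep u hu, dist_triangle (contraction (standardVector M (k + 1)) n s v)
              (contraction (standardVector M (k + 1)) n s u)
              (contraction (standardVector M (k + 1)) n (s + 1) u)]
        · linarith [dist_contraction_le (standardVector M (k + 1)) u v hn
            (Nat.succ_le_of_lt hs), hdist u hu v hv]
    refine Finset.sum_congr rfl fun s hs => ?_
    have hs' := Finset.mem_range.1 hs
    congr 1
    · exact ih (by omega) _ _ (key s hs')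
    · refine ih (by omega) _ _ fun l hl hmem hdist => key s hs' _ (by simpa using hl) ?_ ?_
      · intro v hv
        obtain ⟨w, hw, rfl⟩ := List.mem_map.1 hv
        exact neg_mem_crossSphere (hmem w hw)
      · intro u hu v hv
        obtain ⟨u', hu', rfl⟩ := List.mem_map.1 hu
        obtain ⟨v', hv', rfl⟩ := List.mem_map.1 hv
        rw [dist_neg_neg]
        exact hdist u' hu' v' hv'

theorem hemisphere_zero_cochain {E : Type*} [AddCommGroup E] [Module ℝ E] (e : ℕ → E) (n k : ℕ) :
    hemisphere e n k (fun _ => 0) = 0 := by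
  simpa using hemisphere_add e n k (fun _ => 0) (fun _ => 0)

/-- The cup product is the coboundary of `headCupProduct s`, so its value is that of the latter on
the boundary sphere. Folding the two halves of this sphere gives the cup product on a hemisphere of
one dimension less. -/
theorem hemisphere_cupProduct {M n k : ℕ} (hn : n ≠ 0) (hk : k ≤ M)
    (s : ℕ → (Fin (M + 1) → ℝ) → ZMod 2) (hs : ∀ i v, v ≠ 0 → s i (-v) = s i v + 1) :
    hemisphere (standardVector M) n k (cupProduct s) = 1 := by
  induction k with
  | zero => rfl
  | succ k ih =>
    rw [hemisphere_congr hn hk (cupProduct s) (coboundary (headCupProduct s)),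
      hemisphere_coboundary _ hn, sphereEval, ← hemisphere_add, ← ih (by omega)]
    · exact hemisphere_congr hn (by omega) _ _ fun l _ hl _ =>
        headCupProduct_map_neg s l fun i v hv => hs i v (ne_zero_of_mem_crossSphere (hl v hv))
    · intro l hl _ _
      match l, hl with
      | u :: v :: l, _ => exact (coboundary_headCupProduct s u v l).symm

/-- No continuity is required, so a well-order may choose one point from each antipodal pair. -/
theorem exists_odd_sign (E : Type*) [AddCommGroup E] [Module ℝ E] :
    ∃ s : E → ZMod 2, ∀ v, v ≠ 0 → s (-v) = s v + 1 := by
  classical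
  refine ⟨fun v => if WellOrderingRel v (-v) then 1 else 0, fun v hv => ?_⟩
  have hne : v ≠ -v := fun h => hv <| by
    have h2 : (2 : ℝ) • v = 0 := by
      rw [two_smul]
      exact eq_neg_iff_add_eq_zero.1 h
    exact (smul_eq_zero.1 h2).resolve_left two_ne_zero
  simp only [neg_neg]
  rcases trichotomous_of WellOrderingRel v (-v) with h | h | h
  · rw [if_pos h, if_neg (asymm_of WellOrderingRel h)]
    decide
  · exact absurd h hne
  · rw [if_pos h, if_neg (asymm_of WellOrderingRel h)]
    decide

/-- The **Lusternik–Schnirelmann theorem**: the `M`-dimensional sphere is not covered by `M` open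
sets disjoint from their antipodes, together with those antipodes. -/
theorem exists_ne_zero_forall_notMem_antipodal (M : ℕ) (U : ℕ → Set (Fin (M + 1) → ℝ))
    (hU : ∀ i, IsOpen (U i)) (hanti : ∀ i, ∀ v ∈ U i, -v ∉ U i) :
    ∃ v : Fin (M + 1) → ℝ, v ≠ 0 ∧ ∀ i < M, v ∉ U i ∧ -v ∉ U i := by
  classical
  by_contra! hcon
  have hcompact : IsCompact (crossSphere M M) := by
    refine Metric.isCompact_of_isClosed_isBounded ?_ ?_
    · have : crossSphere M M = {v | ∑ i, |v i| = 1} := by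
        ext v
        exact ⟨fun h => h.1, fun h => ⟨h, fun i hi => by omega⟩⟩
      rw [this]
      exact isClosed_eq (by fun_prop) continuous_const
    · exact (Metric.isBounded_closedBall (x := (0 : Fin (M + 1) → ℝ)) (r := 1)).subset
        fun v hv => by simpa using norm_le_one_of_mem_crossSphere hv
  obtain ⟨δ, hδ, hball⟩ := lebesgue_number_lemma_of_metric (ι := Fin M × Bool)
    (c := fun i => if i.2 then U i.1 else -U i.1) hcompact
    (by
      rintro ⟨i, b⟩
      cases b
      · simpa using (hU i).neg
      · simpa using hU i)
    (by
      intro v hv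
      obtain ⟨i, hi, h⟩ := hcon v (ne_zero_of_mem_crossSphere hv)
      refine Set.mem_iUnion.2 ?_
      by_cases hvU : v ∈ U i
      · exact ⟨(⟨i, hi⟩, true), by simpa using hvU⟩
      · exact ⟨(⟨i, hi⟩, false), by simpa using h hvU⟩)
  obtain ⟨s, hs⟩ := exists_odd_sign (Fin (M + 1) → ℝ)
  -- An odd function equal to 1 on `U i` and 0 on its antipode, hence constant on each set of the
  -- cover.
  let t : ℕ → (Fin (M + 1) → ℝ) → ZMod 2 := fun i v =>
    if v ∈ U i then 1 else if -v ∈ U i then 0 else s v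
  have ht : ∀ i v, v ≠ 0 → t i (-v) = t i v + 1 := by
    intro i v hv
    simp only [t, neg_neg]
    by_cases h1 : v ∈ U i
    · rw [if_neg (hanti i v h1), if_pos h1, if_pos h1]
      decide
    · by_cases h2 : -v ∈ U i
      · rw [if_pos h2, if_neg h1, if_pos h2]
        decide
      · rw [if_neg h2, if_neg h1, if_neg h1, if_neg h2, hs v hv]
  obtain ⟨n, hn⟩ := exists_nat_gt (2 * M / δ)
  have hn0 : n ≠ 0 := by
    rintro rfl
    have : (0 : ℝ) ≤ 2 * M / δ := by positivity
    simp at hn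
    linarith
  have hn' : (0 : ℝ) < n := by positivity
  have hsmall : 2 * (M : ℝ) / n < δ := by
    rw [div_lt_iff₀ hδ] at hn
    rw [div_lt_iff₀ hn']
    linarith
  have h1 := hemisphere_cupProduct hn0 le_rfl t ht
  rw [hemisphere_congr hn0 le_rfl (cupProduct t) (fun _ => 0), hemisphere_zero_cochain] at h1
  · exact zero_ne_one h1
  · intro l hl hmem hdist
    obtain ⟨x, hx⟩ := List.exists_mem_of_length_pos (l := l) (by omega)
    obtain ⟨⟨i, b⟩, hi⟩ := hball x (hmem x hx)
    have hsub : ∀ v ∈ l, v ∈ (if b then U i else -U i : Set (Fin (M + 1) → ℝ)) := fun v hv =>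
      hi ((hdist v hv x hx).trans_lt hsmall)
    refine cupProduct_eq_zero t i l (by omega) fun u hu v hv => ?_
    have hu' := hsub u hu
    have hv' := hsub v hv
    simp only [t]
    cases b
    · simp only [Bool.false_eq_true, if_false, Set.mem_neg] at hu' hv'
      have h3 : u ∉ U i := fun h => hanti i u h hu'
      have h4 : v ∉ U i := fun h => hanti i v h hv'
      rw [if_neg h3, if_neg h4, if_pos hu', if_pos hv']
    · simp only [if_true] at hu' hv'
      rw [if_pos hu', if_pos hv']

end LusternikSchnirelmann

/-! ### The ham sandwich theorem for finite sets. -/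

section HamSandwich

/-- The discrete **ham sandwich theorem** for linear combinations of one more function than there
are sets. -/
theorem exists_bisecting_combination {E κ : Type*} [Fintype κ] (S : κ → Finset E)
    (φ : Fin (Fintype.card κ + 1) → E → ℝ) :
    ∃ c : Fin (Fintype.card κ + 1) → ℝ, c ≠ 0 ∧ ∀ k,
      2 * ((S k).filter (fun x => 0 < ∑ i, c i * φ i x)).card ≤ (S k).card ∧
      2 * ((S k).filter (fun x => ∑ i, c i * φ i x < 0)).card ≤ (S k).card := by
  classical
  let e := Fintype.equivFin κ
  -- The coefficient vectors positive on more than half of `S k`. Antipodal vectors cannot both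
  -- qualify, since the positive and negative parts are disjoint.
  let P : κ → Set (Fin (Fintype.card κ + 1) → ℝ) := fun k =>
    {c | (S k).card < 2 * ((S k).filter (fun x => 0 < ∑ i, c i * φ i x)).card}
  have hopen (k : κ) : IsOpen (P k) := by
    rw [isOpen_iff_mem_nhds]
    intro c hc
    have h : ∀ᶠ c' in nhds c, ∀ x ∈ (S k).filter (fun x => 0 < ∑ i, c i * φ i x),
        0 < ∑ i, c' i * φ i x := by
      rw [Filter.eventually_all_finset]
      intro x hx
      have hcont : Continuous fun c' : Fin (Fintype.card κ + 1) → ℝ => ∑ i, c' i * φ i x := by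
        fun_prop
      exact hcont.continuousAt.eventually (lt_mem_nhds (Finset.mem_filter.1 hx).2)
    filter_upwards [h] with c' hc'
    refine lt_of_lt_of_le hc (Nat.mul_le_mul_left 2 (Finset.card_le_card fun x hx => ?_))
    exact Finset.mem_filter.2 ⟨(Finset.mem_filter.1 hx).1, hc' x hx⟩
  have hneg (c : Fin (Fintype.card κ + 1) → ℝ) (x : E) :
      ∑ i, (-c) i * φ i x = -∑ i, c i * φ i x := by simp
  have hanti (k : κ) (c) (hc : c ∈ P k) : -c ∉ P k := by
    intro hc'
    simp only [P, Set.mem_ofPred_eq, hneg, Left.neg_pos_iff] at hc hc'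
    have hdisj : Disjoint ((S k).filter (fun x => 0 < ∑ i, c i * φ i x))
        ((S k).filter (fun x => ∑ i, c i * φ i x < 0)) := by
      rw [Finset.disjoint_filter]
      intro x _ h1 h2
      exact lt_asymm h1 h2
    have hle := Finset.card_le_card (Finset.union_subset
      (Finset.filter_subset (fun x => 0 < ∑ i, c i * φ i x) (S k))
      (Finset.filter_subset (fun x => ∑ i, c i * φ i x < 0) (S k)))
    rw [Finset.card_union_of_disjoint hdisj] at hle
    omega
  obtain ⟨c, hc0, hc⟩ := exists_ne_zero_forall_notMem_antipodal (Fintype.card κ)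
    (fun i => if h : i < Fintype.card κ then P (e.symm ⟨i, h⟩) else ∅)
    (fun i => by
      split_ifs with h
      · exact hopen _
      · exact isOpen_empty)
    (fun i v hv => by
      split_ifs at hv ⊢ with h
      · exact hanti _ v hv
      · simp)
  refine ⟨c, hc0, fun k => ?_⟩
  have h := hc (e k) (e k).2
  simpa only [Fin.is_lt, dite_true, Fin.eta, Equiv.symm_apply_apply, P, Set.mem_ofPred_eq, hneg,
    Left.neg_pos_iff, not_lt] using h

end HamSandwich

/-! ### Bisecting polynomials and their iteration. -/

section Partition

open MvPolynomial

/-- Finitely many finite sets are bisected by a polynomial of controlled degree. -/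
theorem exists_bisecting_polynomial {E κ : Type*} [Fintype κ] {n e : ℕ} (f : E → Fin n → ℝ)
    (S : κ → Finset E) (he : Fintype.card κ < (e + 1) ^ n) :
    ∃ p : MvPolynomial (Fin n) ℝ, p ≠ 0 ∧ p.totalDegree ≤ n * e ∧ ∀ k,
      2 * ((S k).filter (fun x => 0 < eval (f x) p)).card ≤ (S k).card ∧
      2 * ((S k).filter (fun x => eval (f x) p < 0)).card ≤ (S k).card := by
  classical
  -- The monomials with every exponent at most `e` number `(e + 1) ^ n` and have total degree at
  -- most `n * e`.
  have hcard : Fintype.card (Fin (Fintype.card κ + 1)) ≤ Fintype.card (Fin n → Fin (e + 1)) := by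
    simpa using he
  obtain ⟨g⟩ := Function.Embedding.nonempty_of_card_le hcard
  let m : Fin (Fintype.card κ + 1) → (Fin n →₀ ℕ) := fun i =>
    Finsupp.equivFunOnFinite.symm fun a => (g i a : ℕ)
  have hm : Function.Injective m := by
    intro i j hij
    apply g.injective
    funext a
    have := DFunLike.congr_fun hij a
    simpa [m, Fin.ext_iff] using this
  obtain ⟨c, hc0, hc⟩ := exists_bisecting_combination S fun i x => eval (f x) (monomial (m i) 1)
  have heval (x : E) : eval (f x) (∑ i, monomial (m i) (c i)) =
      ∑ i, c i * eval (f x) (monomial (m i) 1) := by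
    rw [map_sum]
    refine Finset.sum_congr rfl fun i _ => ?_
    simp [eval_monomial]
  refine ⟨∑ i, monomial (m i) (c i), ?_, ?_, ?_⟩
  · intro h0
    apply hc0
    funext i
    have h := congrArg (coeff (m i)) h0
    simpa [coeff_sum, coeff_monomial, hm.eq_iff] using h
  · refine totalDegree_finsetSum_le fun i _ => (totalDegree_monomial_le _ _).trans ?_
    rw [Finsupp.sum_fintype _ _ fun _ => rfl]
    calc ∑ a, id (m i a) ≤ ∑ _a : Fin n, e := Finset.sum_le_sum fun a _ => by
          simpa [m] using Nat.lt_succ_iff.1 (g i a).2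
      _ = n * e := by simp
  · simpa only [heval] using hc

/-- The polynomial of step `j` bisects all `2 ^ j` current cells at once. Exponents up to the floor
of `2 ^ (j / n)` provide more than `2 ^ j` monomials. -/
theorem exists_sign_partition {E : Type*} {n : ℕ} (hn : 0 < n) (f : E → Fin n → ℝ)
    (X : Finset E) (J : ℕ) :
    ∃ ps : ℕ → MvPolynomial (Fin n) ℝ, (∀ j < J, ps j ≠ 0 ∧
        (ps j).totalDegree ≤ n * ⌊((2 : ℝ) ^ (1 / n : ℝ)) ^ j⌋₊) ∧
      ∀ σ : ℕ → Bool, 2 ^ J * (X.filter (fun x => ∀ j < J, eval (f x) (ps j) ≠ 0 ∧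
        decide (0 < eval (f x) (ps j)) = σ j)).card ≤ X.card := by
  classical
  induction J with
  | zero => exact ⟨fun _ => 1, by simp, by simp⟩
  | succ J ih =>
    obtain ⟨ps, hps, hcell⟩ := ih
    have hcard : Fintype.card (Fin J → Bool) < (⌊((2 : ℝ) ^ (1 / n : ℝ)) ^ J⌋₊ + 1) ^ n := by
      have h1 : (((2 : ℝ) ^ (1 / n : ℝ)) ^ J) ^ n = 2 ^ J := by
        rw [← pow_mul, mul_comm J n, pow_mul, one_div, Real.rpow_inv_natCast_pow (by norm_num)
          (by omega)]
      have h2 := pow_lt_pow_left₀ (Nat.lt_floor_add_one (((2 : ℝ) ^ (1 / n : ℝ)) ^ J))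
        (by positivity) hn.ne'
      rw [h1] at h2
      simp only [Fintype.card_pi, Fintype.card_bool, Finset.prod_const, Finset.card_univ,
        Fintype.card_fin]
      exact_mod_cast h2
    obtain ⟨p, hp0, hpd, hp⟩ := exists_bisecting_polynomial f (fun σ : Fin J → Bool =>
      X.filter (fun x => ∀ j : Fin J, eval (f x) (ps j) ≠ 0 ∧
        decide (0 < eval (f x) (ps j)) = σ j)) hcard
    refine ⟨Function.update ps J p, ?_, ?_⟩
    · intro j hj
      rcases eq_or_ne j J with rfl | hne
      · rw [Function.update_self]
        exact ⟨hp0, hpd⟩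
      · rw [Function.update_of_ne hne]
        exact hps j (by omega)
    · intro σ
      have h1 := hp fun j => σ j
      have h2 := hcell σ
      have h3 : (X.filter (fun x => ∀ j < J, eval (f x) (ps j) ≠ 0 ∧
          decide (0 < eval (f x) (ps j)) = σ j)) =
          X.filter (fun x => ∀ j : Fin J, eval (f x) (ps j) ≠ 0 ∧
            decide (0 < eval (f x) (ps j)) = σ j) := by
        refine Finset.filter_congr fun x _ => ?_
        exact ⟨fun h j => h j j.2, fun h j hj => h ⟨j, hj⟩⟩
      rw [h3] at h2
      have hsub (x : E) (hx : ∀ j < J + 1, eval (f x) (Function.update ps J p j) ≠ 0 ∧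
          decide (0 < eval (f x) (Function.update ps J p j)) = σ j) :
          (∀ j : Fin J, eval (f x) (ps j) ≠ 0 ∧ decide (0 < eval (f x) (ps j)) = σ j) ∧
          eval (f x) p ≠ 0 ∧ decide (0 < eval (f x) p) = σ J := by
        constructor
        · intro j
          simpa [j.2.ne] using hx j (by omega)
        · simpa using hx J (by omega)
      rw [pow_succ, mul_assoc]
      refine le_trans (Nat.mul_le_mul_left _ ?_) h2
      cases hσ : σ J with
      | true =>
        refine le_trans (Nat.mul_le_mul_left 2 (Finset.card_le_card fun x hx => ?_)) h1.1
        obtain ⟨hxX, hx⟩ := Finset.mem_filter.1 hx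
        obtain ⟨ha, hb, hc⟩ := hsub x hx
        refine Finset.mem_filter.2 ⟨Finset.mem_filter.2 ⟨hxX, ha⟩, ?_⟩
        rw [hσ] at hc
        exact of_decide_eq_true hc
      | false =>
        refine le_trans (Nat.mul_le_mul_left 2 (Finset.card_le_card fun x hx => ?_)) h1.2
        obtain ⟨hxX, hx⟩ := Finset.mem_filter.1 hx
        obtain ⟨ha, hb, hc⟩ := hsub x hx
        refine Finset.mem_filter.2 ⟨Finset.mem_filter.2 ⟨hxX, ha⟩, ?_⟩
        rw [hσ] at hc
        exact lt_of_le_of_ne (not_lt.1 (of_decide_eq_false hc)) hb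

end Partition

/-! ### Sign patterns and polynomials along a line. -/

section LineCrossing

open Polynomial

/-- Along the real line, the signs of polynomials of total degree at most `D` take at most `D + 1`
values away from the zeros. -/
theorem card_image_signs_le {ι : Type*} [Fintype ι] [DecidableEq ι] (g : ι → ℝ[X]) {D : ℕ}
    (hD : (∏ j, g j).natDegree ≤ D) (s : Finset ℝ) (hs : ∀ t ∈ s, (∏ j, g j).eval t ≠ 0) :
    (s.image (fun t j => decide (0 < (g j).eval t))).card ≤ D + 1 := by
  classical
  set G := ∏ j, g j with hG
  -- Points with equally many roots to their left have no root between them, so the intermediate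
  -- value theorem gives equal signs.
  let c : ℝ → ℕ := fun t => (G.roots.toFinset.filter (· < t)).card
  have hc (t : ℝ) : c t ≤ D :=
    (Finset.card_filter_le _ _).trans
      ((Multiset.toFinset_card_le _).trans ((Polynomial.card_roots' G).trans hD))
  have hsame' : ∀ t ∈ s, ∀ t' ∈ s, t ≤ t' → c t = c t' →
      (fun j => decide (0 < (g j).eval t)) = fun j => decide (0 < (g j).eval t') := by
    intro t ht t' ht' hle hcc
    have hG0 : G ≠ 0 := by
      intro h
      apply hs t ht
      rw [h, eval_zero]
    have hsub : G.roots.toFinset.filter (· < t) ⊆ G.roots.toFinset.filter (· < t') := by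
      intro r hr
      rw [Finset.mem_filter] at hr ⊢
      exact ⟨hr.1, hr.2.trans_le hle⟩
    have heq := Finset.eq_of_subset_of_card_le hsub hcc.ge
    have hroot : ∀ r ∈ Set.Icc t t', G.eval r ≠ 0 := by
      intro r hr h0
      have hrt' : r < t' := lt_of_le_of_ne hr.2 (by rintro rfl; exact hs _ ht' h0)
      have hmem : r ∈ G.roots.toFinset.filter (· < t') := by
        rw [Finset.mem_filter, Multiset.mem_toFinset, mem_roots hG0]
        exact ⟨h0, hrt'⟩
      rw [← heq, Finset.mem_filter] at hmem
      exact absurd hmem.2 (not_lt.2 hr.1)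
    have hrootj (j : ι) : ∀ r ∈ Set.Icc t t', (g j).eval r ≠ 0 := by
      intro r hr h0
      apply hroot r hr
      rw [hG, eval_prod]
      exact Finset.prod_eq_zero (Finset.mem_univ j) h0
    funext j
    have hcont : ContinuousOn (fun r => (g j).eval r) (Set.Icc t t') := (g j).continuousOn
    rw [decide_eq_decide]
    constructor
    · intro hpos
      by_contra hneg
      obtain ⟨r, hr, h0⟩ := intermediate_value_Icc' hle hcont ⟨not_lt.1 hneg, hpos.le⟩
      exact hrootj j r hr h0
    · intro hpos
      by_contra hneg
      obtain ⟨r, hr, h0⟩ := intermediate_value_Icc hle hcont ⟨not_lt.1 hneg, hpos.le⟩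
      exact hrootj j r hr h0
  have hsame : ∀ t ∈ s, ∀ t' ∈ s, c t = c t' →
      (fun j => decide (0 < (g j).eval t)) = fun j => decide (0 < (g j).eval t') := by
    intro t ht t' ht' hcc
    rcases le_total t t' with h | h
    · exact hsame' t ht t' ht' h hcc
    · exact (hsame' t' ht' t ht h hcc.symm).symm
  have hsub : s.image (fun t j => decide (0 < (g j).eval t)) ⊆
      (Finset.range (D + 1)).image fun m j =>
        decide (0 < (g j).eval (Function.invFunOn c (s : Set ℝ) m)) := by
    intro σ hσ
    obtain ⟨t, ht, rfl⟩ := Finset.mem_image.1 hσ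
    refine Finset.mem_image.2 ⟨c t, Finset.mem_range.2 (Nat.lt_succ_of_le (hc t)), ?_⟩
    have hex : ∃ a ∈ (s : Set ℝ), c a = c t := ⟨t, ht, rfl⟩
    exact hsame _ (Function.invFunOn_mem hex) _ ht (Function.invFunOn_eq hex)
  exact (Finset.card_le_card hsub).trans (Finset.card_image_le.trans (by simp))

/-- The restriction of a polynomial to the line through `a` with direction `u`. -/
noncomputable def lineRestriction {n : ℕ} (a u : Fin n → ℝ) :
    MvPolynomial (Fin n) ℝ →ₐ[ℝ] ℝ[X] :=
  MvPolynomial.aeval fun i => C (a i) + C (u i) * X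

theorem eval_lineRestriction {n : ℕ} (a u : Fin n → ℝ) (p : MvPolynomial (Fin n) ℝ) (t : ℝ) :
    (lineRestriction a u p).eval t = MvPolynomial.eval (a + t • u) p := by
  induction p using MvPolynomial.induction_on with
  | C r => simp [lineRestriction]
  | add p q hp hq => simp only [map_add, eval_add, hp, hq]
  | mul_X p i hp =>
    rw [map_mul, eval_mul, hp, map_mul]
    simp [lineRestriction, mul_comm t]

theorem natDegree_lineRestriction_le {n : ℕ} (a u : Fin n → ℝ) (p : MvPolynomial (Fin n) ℝ) :
    (lineRestriction a u p).natDegree ≤ p.totalDegree := by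
  have h := MvPolynomial.aeval_natDegree_le p le_rfl (fun i => C (a i) + C (u i) * X)
    (n := 1) fun i => by
      rw [add_comm]
      exact natDegree_linear_le
  rwa [mul_one] at h

theorem derivative_lineRestriction {n : ℕ} (a u : Fin n → ℝ) (p : MvPolynomial (Fin n) ℝ) :
    derivative (lineRestriction a u p) =
      ∑ i, C (u i) * lineRestriction a u (MvPolynomial.pderiv i p) := by
  induction p using MvPolynomial.induction_on with
  | C r => simp [lineRestriction]
  | add p q hp hq => simp only [map_add, hp, hq, mul_add, Finset.sum_add_distrib]
  | mul_X p i hp =>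
    have h1 : lineRestriction a u (MvPolynomial.X i) = C (a i) + C (u i) * X := by
      simp [lineRestriction]
    have h2 (j : Fin n) : MvPolynomial.pderiv j (p * MvPolynomial.X i) =
        MvPolynomial.pderiv j p * MvPolynomial.X i + p * (if j = i then 1 else 0) := by
      rw [MvPolynomial.pderiv_mul]
      congr 2
      rw [MvPolynomial.pderiv_X, Pi.single_apply]
      simp [eq_comm]
    simp only [h2, map_mul, map_add, derivative_mul, hp, h1, mul_add, Finset.sum_add_distrib]
    simp only [← mul_assoc, ← Finset.sum_mul, apply_ite, map_one, map_zero, mul_one, mul_zero,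
      Finset.sum_ite_eq', Finset.mem_univ, if_true]
    simp
    ring

end LineCrossing

/-! ### Parametrization of lines. -/

section Lines

theorem IsLine.exists_parametrization {l : AffineSubspace ℝ Space3} (hl : IsLine l) :
    ∃ a u : Space3, u ≠ 0 ∧ l.direction = Submodule.span ℝ {u} ∧
      ∀ x, x ∈ l ↔ ∃ t : ℝ, x = a + t • u := by
  have hne : (l : Set Space3).Nonempty := by
    rw [AffineSubspace.nonempty_iff_ne_bot]
    rintro rfl
    rw [IsLine, AffineSubspace.direction_bot, finrank_bot] at hl
    exact zero_ne_one hl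
  obtain ⟨a, ha⟩ := hne
  obtain ⟨⟨u, hu⟩, hu0, hspan⟩ := finrank_eq_one_iff'.1 hl
  have hdir : l.direction = Submodule.span ℝ {u} := by
    refine le_antisymm (fun w hw => ?_) (by simpa using hu)
    obtain ⟨c, hc⟩ := hspan ⟨w, hw⟩
    exact Submodule.mem_span_singleton.2 ⟨c, congrArg Subtype.val hc⟩
  refine ⟨a, u, by simpa using hu0, hdir, fun x => ?_⟩
  rw [← AffineSubspace.vsub_right_mem_direction_iff_mem ha, hdir, Submodule.mem_span_singleton]
  simp only [vsub_eq_sub, eq_sub_iff_add_eq, add_comm _ a, eq_comm]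

end Lines

/-! ### Polynomial partitioning. -/

section PolynomialPartition

open MvPolynomial

/-- **Polynomial partitioning**: the zero set of a polynomial of degree at most `C * 2 ^ (J / n)`
cuts a finite set into cells containing a proportion of at most `2 ^ (-J)` of its points, such that
every line meets at most one more cell than the degree. -/
theorem exists_polynomial_partition {n : ℕ} (hn : 0 < n) : ∃ C : ℝ, 1 ≤ C ∧
    ∀ (π : Space3 →ₗ[ℝ] (Fin n → ℝ)) (X : Finset Space3) (J : ℕ),
    ∃ (p : MvPolynomial (Fin n) ℝ) (D : ℕ) (cell : Space3 → Fin J → Bool),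
      p ≠ 0 ∧ p.totalDegree ≤ D ∧ (D : ℝ) ≤ C * ((2 : ℝ) ^ (1 / n : ℝ)) ^ J ∧
      (∀ σ, 2 ^ J * (X.filter (fun x => eval (π x) p ≠ 0 ∧ cell x = σ)).card ≤ X.card) ∧
      ∀ l, IsLine l → ∀ Y : Finset Space3, (∀ y ∈ Y, y ∈ l ∧ eval (π y) p ≠ 0) →
        (Y.image cell).card ≤ D + 1 := by
  classical
  set q : ℝ := (2 : ℝ) ^ (1 / n : ℝ) with hq
  have hq1 : 1 < q := Real.one_lt_rpow (by norm_num) (by positivity)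
  -- The degrees grow geometrically, with sum at most `n / (q - 1) * q ^ J`. Taking `C ≥ 1` later
  -- lets `C * q ^ J` absorb the `+ 1` in the number of cells met.
  refine ⟨max 1 (n / (q - 1)), le_max_left _ _, fun π X J => ?_⟩
  obtain ⟨ps, hps, hcell⟩ := exists_sign_partition hn π X J
  have hdeg : (∏ j : Fin J, ps j).totalDegree ≤ ∑ j : Fin J, (ps j).totalDegree :=
    totalDegree_finsetProd _ _
  refine ⟨∏ j : Fin J, ps j, ∑ j : Fin J, (ps j).totalDegree,
    fun x j => decide (0 < eval (π x) (ps j)),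
    Finset.prod_ne_zero_iff.2 fun j _ => (hps j j.2).1, hdeg, ?_, ?_, ?_⟩
  · calc ((∑ j : Fin J, (ps j).totalDegree : ℕ) : ℝ)
        ≤ ∑ j : Fin J, n * q ^ (j : ℕ) := by
          push_cast
          refine Finset.sum_le_sum fun j _ => ?_
          have h1 : ((ps j).totalDegree : ℝ) ≤ n * (⌊q ^ (j : ℕ)⌋₊ : ℝ) := by
            exact_mod_cast (hps j j.2).2
          exact h1.trans (mul_le_mul_of_nonneg_left (Nat.floor_le (by positivity))
            (by positivity))
      _ = n * ((q ^ J - 1) / (q - 1)) := by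
          rw [← Finset.mul_sum, Fin.sum_univ_eq_sum_range (fun j => q ^ j), geom_sum_eq hq1.ne']
      _ ≤ n / (q - 1) * q ^ J := by
          rw [← mul_div_assoc, div_mul_eq_mul_div]
          have : (0 : ℝ) ≤ n := by positivity
          gcongr
          linarith
      _ ≤ max 1 (n / (q - 1)) * q ^ J := by
          gcongr
          exact le_max_right _ _
  · intro σ
    refine le_trans (Nat.mul_le_mul_left _ (Finset.card_le_card fun x hx => ?_))
      (hcell fun j => if h : j < J then σ ⟨j, h⟩ else true)
    rw [Finset.mem_filter] at hx ⊢
    refine ⟨hx.1, fun j hj => ⟨?_, ?_⟩⟩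
    · have h := hx.2.1
      rw [map_prod, Finset.prod_ne_zero_iff] at h
      exact h ⟨j, hj⟩ (Finset.mem_univ _)
    · rw [dif_pos hj, ← hx.2.2]
  · intro l hl Y hY
    obtain ⟨a, u, -, -, hmem⟩ := hl.exists_parametrization
    have hpar (y : Space3) : ∃ t : ℝ, y ∈ Y → y = a + t • u := by
      by_cases hy : y ∈ Y
      · obtain ⟨t, ht⟩ := (hmem y).1 (hY y hy).1
        exact ⟨t, fun _ => ht⟩
      · exact ⟨0, fun h => absurd h hy⟩
    choose t ht using hpar
    have heval (y) (hy : y ∈ Y) (p : MvPolynomial (Fin n) ℝ) :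
        (lineRestriction (π a) (π u) p).eval (t y) = eval (π y) p := by
      rw [eval_lineRestriction, ← map_smul, ← map_add, ← ht y hy]
    have h := card_image_signs_le (fun j : Fin J => lineRestriction (π a) (π u) (ps j))
      (D := ∑ j : Fin J, (ps j).totalDegree)
      (by
        rw [← map_prod]
        exact (natDegree_lineRestriction_le _ _ _).trans hdeg)
      (Y.image t)
      (by
        intro r hr
        obtain ⟨y, hy, rfl⟩ := Finset.mem_image.1 hr
        rw [← map_prod, heval y hy]
        exact (hY y hy).2)
    rw [Finset.image_image] at h
    refine le_trans (le_of_eq (congrArg Finset.card (Finset.image_congr fun y hy => ?_))) h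
    funext j
    simp only [Function.comp, heval y hy]

end PolynomialPartition

/-! ### The minimal degree argument for joints. -/

section SparseLine

open MvPolynomial

theorem totalDegree_pderiv_lt {n : ℕ} {Q : MvPolynomial (Fin n) ℝ} {i : Fin n}
    (h : pderiv i Q ≠ 0) : (pderiv i Q).totalDegree < Q.totalDegree := by
  have key : ∀ m ∈ (pderiv i Q).support, (m.sum fun _ e => e) < Q.totalDegree := by
    intro m hm
    rw [mem_support_iff, coeff_pderiv] at hm
    have hmem : m + Finsupp.single i 1 ∈ Q.support := by
      rw [mem_support_iff]
      exact left_ne_zero_of_mul hm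
    have hle := le_totalDegree hmem
    rw [Finsupp.sum_add_index' (fun _ => rfl) (fun _ _ _ => rfl), Finsupp.sum_single_index rfl]
      at hle
    omega
  obtain ⟨m, hm⟩ := support_nonempty.2 h
  exact (Finset.sup_lt_iff (lt_of_le_of_lt bot_le (key m hm))).2 key

theorem eq_C_of_pderiv_eq_zero {n : ℕ} {Q : MvPolynomial (Fin n) ℝ}
    (h : ∀ i, pderiv i Q = 0) : Q = C (coeff 0 Q) := by
  ext m
  rw [coeff_C]
  split_ifs with hm
  · rw [hm]
  · obtain ⟨i, hi⟩ := Finsupp.ne_iff.1 (Ne.symm hm)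
    have h1 := congrArg (coeff (m - Finsupp.single i 1)) (h i)
    have h2 : m - Finsupp.single i 1 + Finsupp.single i 1 = m := by
      refine tsub_add_cancel_of_le (Finsupp.single_le_iff.2 ?_)
      exact Nat.one_le_iff_ne_zero.2 hi
    rw [coeff_pderiv, coeff_zero, h2] at h1
    refine (mul_eq_zero.1 h1).resolve_right ?_
    positivity

/-- The parameter is that of the line in space, so distinct points give distinct roots even if `π`
collapses the line. -/
theorem lineRestriction_eq_zero {n : ℕ} {π : Space3 →ₗ[ℝ] (Fin n → ℝ)} {a u : Space3}
    {Q : MvPolynomial (Fin n) ℝ} (Y : Finset Space3) (hY : ∀ y ∈ Y, ∃ t : ℝ, y = a + t • u)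
    (hQ : ∀ y ∈ Y, eval (π y) Q = 0) (hcard : Q.totalDegree < Y.card) :
    lineRestriction (π a) (π u) Q = 0 := by
  choose! t ht using hY
  have hinj : Set.InjOn t Y := fun x hx y hy hxy => by rw [ht x hx, ht y hy, hxy]
  refine Polynomial.eq_zero_of_natDegree_lt_card_of_eval_eq_zero' _ (Y.image t) ?_ ?_
  · intro r hr
    obtain ⟨y, hy, rfl⟩ := Finset.mem_image.1 hr
    rw [eval_lineRestriction, ← map_smul, ← map_add, ← ht y hy, hQ y hy]
  · rw [Finset.card_image_of_injOn hinj]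
    exact (natDegree_lineRestriction_le _ _ _).trans_lt hcard

/-- If the points of `X` lie on a surface of degree at most `D` and the projected directions of the
lines through each of them span, then one of the lines contains at most `D` points of `X`. -/
theorem exists_line_card_le {n D : ℕ} {π : Space3 →ₗ[ℝ] (Fin n → ℝ)}
    {A : Finset (AffineSubspace ℝ Space3)} (hA : ∀ l ∈ A, IsLine l) {X : Finset Space3}
    (hX : X.Nonempty) {p : MvPolynomial (Fin n) ℝ} (hp : p ≠ 0) (hpD : p.totalDegree ≤ D)
    (hpX : ∀ x ∈ X, eval (π x) p = 0)
    (hspan : ∀ x ∈ X, ∃ T ⊆ A, (∀ l ∈ T, x ∈ l) ∧ ⨆ l ∈ T, l.direction.map π = ⊤) :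
    ∃ l ∈ A, ({x ∈ X | x ∈ l} : Set Space3).ncard ≤ D := by
  classical
  by_contra! hcon
  -- A polynomial of least degree vanishing on `X`. Its partial derivatives will also vanish on `X`,
  -- so minimality forces them to be zero.
  obtain ⟨Q, ⟨hQ0, hQX⟩, hmin⟩ := WellFounded.has_min
    (measure (totalDegree : MvPolynomial (Fin n) ℝ → ℕ)).wf
    {Q | Q ≠ 0 ∧ ∀ x ∈ X, eval (π x) Q = 0} ⟨p, hp, hpX⟩
  have hmin' (R : MvPolynomial (Fin n) ℝ) (hR : R ≠ 0) (hRX : ∀ x ∈ X, eval (π x) R = 0) :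
      Q.totalDegree ≤ R.totalDegree := not_lt.1 (hmin R ⟨hR, hRX⟩)
  have hQD : Q.totalDegree ≤ D := (hmin' p hp hpX).trans hpD
  have hgrad : ∀ i, ∀ x ∈ X, eval (π x) (pderiv i Q) = 0 := by
    intro i x hx
    obtain ⟨T, hTA, hTx, hT⟩ := hspan x hx
    let g : (Fin n → ℝ) →ₗ[ℝ] ℝ :=
      ∑ j, (eval (π x) (pderiv j Q)) • LinearMap.proj j
    have hg (w : Fin n → ℝ) : g w = ∑ j, eval (π x) (pderiv j Q) * w j := by
      simp [g, LinearMap.sum_apply]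
    have hker : (⊤ : Submodule ℝ (Fin n → ℝ)) ≤ LinearMap.ker g := by
      rw [← hT]
      refine iSup₂_le fun l hl => ?_
      obtain ⟨a, u, hu, hdir, hmem⟩ := (hA l (hTA hl)).exists_parametrization
      rw [hdir, Submodule.map_span, Set.image_singleton, Submodule.span_singleton_le_iff_mem,
        LinearMap.mem_ker, hg]
      -- The line carries more than `D` zeros of `Q`, whose degree is at most `D`. So `Q` vanishes
      -- along it, and its gradient at `x` annihilates the direction.
      have hzero : lineRestriction (π a) (π u) Q = 0 := by
        refine lineRestriction_eq_zero (X.filter (· ∈ l))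
          (fun y hy => (hmem y).1 (Finset.mem_filter.1 hy).2)
          (fun y hy => hQX y (Finset.mem_filter.1 hy).1) ?_
        have h := hcon l (hTA hl)
        rw [show ({x ∈ X | x ∈ l} : Set Space3) = (X.filter (· ∈ l) : Finset Space3) by
          ext; simp, Set.ncard_coe_finset] at h
        omega
      have hder := derivative_lineRestriction (π a) (π u) Q
      rw [hzero, Polynomial.derivative_zero] at hder
      obtain ⟨t, ht⟩ := (hmem x).1 (hTx l hl)
      have h := congrArg (Polynomial.eval t) hder
      simp only [Polynomial.eval_zero, Polynomial.eval_finsetSum, Polynomial.eval_mul,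
        Polynomial.eval_C, eval_lineRestriction, ← map_smul, ← map_add, ← ht] at h
      rw [h]
      exact Finset.sum_congr rfl fun j _ => mul_comm _ _
    have h := hker (Submodule.mem_top (x := Pi.single i (1 : ℝ)))
    rw [LinearMap.mem_ker, hg] at h
    simpa [Pi.single_apply] using h
  have hQC : Q = C (coeff 0 Q) := eq_C_of_pderiv_eq_zero fun i => by
    by_contra hne
    exact absurd (hmin' _ hne (hgrad i)) (not_le.2 (totalDegree_pderiv_lt hne))
  obtain ⟨x, hx⟩ := hX
  have h := hQX x hx
  rw [hQC, eval_C] at h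
  rw [h, C_0] at hQC
  exact hQ0 hQC

end SparseLine

/-! ### Counting spanning sets by deleting lines. -/

section SpanningSubsets

open Classical in
/-- The `n`-element sets of lines of `A` through `x` whose projected directions span. -/
noncomputable def spanningSubsets {n : ℕ} (π : Space3 →ₗ[ℝ] (Fin n → ℝ))
    (A : Finset (AffineSubspace ℝ Space3)) (x : Space3) :
    Finset (Finset (AffineSubspace ℝ Space3)) :=
  A.powerset.filter fun T => T.card = n ∧ (∀ l ∈ T, x ∈ l) ∧ ⨆ l ∈ T, l.direction.map π = ⊤

theorem mem_spanningSubsets {n : ℕ} {π : Space3 →ₗ[ℝ] (Fin n → ℝ)}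
    {A : Finset (AffineSubspace ℝ Space3)} {x : Space3} {T : Finset (AffineSubspace ℝ Space3)} :
    T ∈ spanningSubsets π A x ↔
      T ⊆ A ∧ T.card = n ∧ (∀ l ∈ T, x ∈ l) ∧ ⨆ l ∈ T, l.direction.map π = ⊤ := by
  simp [spanningSubsets]

open Classical in
theorem card_spanningSubsets_filter_mem_le {n : ℕ} (π : Space3 →ₗ[ℝ] (Fin n → ℝ))
    (A : Finset (AffineSubspace ℝ Space3)) (x : Space3) (l : AffineSubspace ℝ Space3) :
    ((spanningSubsets π A x).filter (l ∈ ·)).card ≤ (A.filter (x ∈ ·)).card ^ (n - 1) := by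
  calc ((spanningSubsets π A x).filter (l ∈ ·)).card
      ≤ ((A.filter (x ∈ ·)).powersetCard (n - 1)).card := by
        refine Finset.card_le_card_of_injOn (fun T => T.erase l) ?_ ?_
        · intro T hT
          obtain ⟨hT, hl⟩ := Finset.mem_filter.1 hT
          obtain ⟨hTA, hcard, hx, -⟩ := mem_spanningSubsets.1 hT
          refine Finset.mem_powersetCard.2 ⟨fun m hm => ?_, ?_⟩
          · have hm' := Finset.mem_of_mem_erase hm
            exact Finset.mem_filter.2 ⟨hTA hm', hx m hm'⟩
          · rw [Finset.card_erase_of_mem hl, hcard]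
        · intro T hT T' hT' heq
          have h1 := (Finset.mem_filter.1 hT).2
          have h2 := (Finset.mem_filter.1 hT').2
          have h : T.erase l = T'.erase l := heq
          rw [← Finset.insert_erase h1, ← Finset.insert_erase h2, h]
    _ = (A.filter (x ∈ ·)).card.choose (n - 1) := Finset.card_powersetCard _ _
    _ ≤ _ := Nat.choose_le_pow _ _

open Classical in
/-- Points on a surface of degree `D` lie, with multiplicity, on few spanning sets of lines. -/
theorem sum_card_spanningSubsets_le {n D K : ℕ} {π : Space3 →ₗ[ℝ] (Fin n → ℝ)}
    {A : Finset (AffineSubspace ℝ Space3)} (hA : ∀ l ∈ A, IsLine l) {X : Finset Space3}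
    {p : MvPolynomial (Fin n) ℝ} (hp : p ≠ 0) (hpD : p.totalDegree ≤ D)
    (hpX : ∀ x ∈ X, MvPolynomial.eval (π x) p = 0)
    (hK : ∀ x ∈ X, ∀ l ∈ A, ((spanningSubsets π A x).filter (l ∈ ·)).card ≤ K) :
    ∑ x ∈ X, (spanningSubsets π A x).card ≤ K * D * A.card := by
  induction hN : A.card generalizing A X with
  | zero =>
    rcases X.eq_empty_or_nonempty with rfl | hX
    · simp
    have hX' : ∀ x ∈ X, spanningSubsets π A x = ∅ := by
      intro x hx
      by_contra hne
      obtain ⟨T, hT⟩ := Finset.nonempty_iff_ne_empty.2 hne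
      obtain ⟨hTA, -, hTx, htop⟩ := mem_spanningSubsets.1 hT
      obtain ⟨l, hl, -⟩ := exists_line_card_le hA (Finset.singleton_nonempty x) hp hpD
        (by simpa using hpX x hx) (by simpa using ⟨T, hTA, hTx, htop⟩)
      rw [Finset.card_eq_zero.1 hN] at hl
      simp at hl
    simp [Finset.sum_congr rfl fun x hx => congrArg Finset.card (hX' x hx)]
  | succ N ih =>
    -- Only points that still have a spanning set may enter the minimal degree argument; the others
    -- contribute nothing to the sum.
    set X' := X.filter fun x => (spanningSubsets π A x).Nonempty with hX'
    have hsum : ∑ x ∈ X, (spanningSubsets π A x).card =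
        ∑ x ∈ X', (spanningSubsets π A x).card := by
      rw [hX', Finset.sum_filter_of_ne]
      intro x _ hne
      exact Finset.card_pos.1 (Nat.pos_of_ne_zero hne)
    rw [hsum]
    rcases X'.eq_empty_or_nonempty with h0 | hne
    · simp [h0]
    obtain ⟨l, hl, hlcard⟩ := exists_line_card_le hA hne hp hpD
      (fun x hx => hpX x (Finset.mem_filter.1 hx).1) (fun x hx => by
        obtain ⟨T, hT⟩ := (Finset.mem_filter.1 hx).2
        obtain ⟨hTA, -, hTx, htop⟩ := mem_spanningSubsets.1 hT
        exact ⟨T, hTA, hTx, htop⟩)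
    rw [show ({x ∈ X' | x ∈ l} : Set Space3) = (X'.filter (· ∈ l) : Finset Space3) by
      ext; simp, Set.ncard_coe_finset] at hlcard
    have hstep (x) (hx : x ∈ X') : (spanningSubsets π A x).card ≤
        (spanningSubsets π (A.erase l) x).card + if x ∈ l then K else 0 := by
      rw [← Finset.card_filter_add_card_filter_not (s := spanningSubsets π A x) (l ∈ ·), add_comm]
      refine add_le_add (Finset.card_le_card fun T hT => ?_) ?_
      · obtain ⟨hT, hlT⟩ := Finset.mem_filter.1 hT
        obtain ⟨hTA, h⟩ := mem_spanningSubsets.1 hT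
        refine mem_spanningSubsets.2 ⟨fun m hm => Finset.mem_erase.2 ⟨?_, hTA hm⟩, h⟩
        rintro rfl
        exact hlT hm
      · split_ifs with hxl
        · exact hK x (Finset.mem_filter.1 hx).1 l hl
        · rw [Nat.le_zero, Finset.card_eq_zero, Finset.filter_eq_empty_iff]
          intro T hT hlT
          exact hxl ((mem_spanningSubsets.1 hT).2.2.1 l hlT)
    have hmono (x : Space3) (m : AffineSubspace ℝ Space3) :
        ((spanningSubsets π (A.erase l) x).filter (m ∈ ·)).card ≤
          ((spanningSubsets π A x).filter (m ∈ ·)).card := by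
      refine Finset.card_le_card (Finset.filter_subset_filter _ fun T hT => ?_)
      obtain ⟨hTA, h⟩ := mem_spanningSubsets.1 hT
      exact mem_spanningSubsets.2 ⟨hTA.trans (Finset.erase_subset _ _), h⟩
    have hrec := ih (A := A.erase l) (X := X')
      (fun m hm => hA m (Finset.mem_of_mem_erase hm))
      (fun x hx => hpX x (Finset.mem_filter.1 hx).1)
      (fun x hx m hm => (hmono x m).trans
        (hK x (Finset.mem_filter.1 hx).1 m (Finset.mem_of_mem_erase hm)))
      (by rw [Finset.card_erase_of_mem hl, hN]; rfl)
    calc ∑ x ∈ X', (spanningSubsets π A x).card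
        ≤ ∑ x ∈ X', ((spanningSubsets π (A.erase l) x).card + if x ∈ l then K else 0) :=
          Finset.sum_le_sum hstep
      _ = ∑ x ∈ X', (spanningSubsets π (A.erase l) x).card + (X'.filter (· ∈ l)).card * K := by
          rw [Finset.sum_add_distrib, ← Finset.sum_filter, Finset.sum_const, smul_eq_mul]
      _ ≤ K * D * N + D * K := add_le_add hrec (Nat.mul_le_mul_right _ hlcard)
      _ = K * D * (N + 1) := by ring

end SpanningSubsets

/-! ### Generic projections and incidence counts. -/

section LineIncidence

theorem IsLine.eq_of_mem_of_mem {l l' : AffineSubspace ℝ Space3} (hl : IsLine l) (hl' : IsLine l')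
    {x y : Space3} (hxy : x ≠ y) (hx : x ∈ l) (hy : y ∈ l) (hx' : x ∈ l') (hy' : y ∈ l') :
    l = l' := by
  have key {m : AffineSubspace ℝ Space3} (hm : IsLine m) (hx : x ∈ m) (hy : y ∈ m) :
      Submodule.span ℝ {x - y} = m.direction := by
    refine Submodule.eq_of_le_of_finrank_eq ?_ ?_
    · rw [Submodule.span_singleton_le_iff_mem]
      exact AffineSubspace.vsub_mem_direction hx hy
    · rw [finrank_span_singleton (sub_ne_zero.2 hxy)]
      exact hm.symm
  exact AffineSubspace.ext_of_direction_eq ((key hl hx hy).symm.trans (key hl' hx' hy'))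
    ⟨x, hx, hx'⟩

theorem IsLine.finrank_sup_direction {l l' : AffineSubspace ℝ Space3} (hl : IsLine l)
    (hl' : IsLine l') (hne : l ≠ l') {x : Space3} (hx : x ∈ l) (hx' : x ∈ l') :
    Module.finrank ℝ ↥(l.direction ⊔ l'.direction) = 2 := by
  have hdir : l.direction ≠ l'.direction := fun h =>
    hne (AffineSubspace.ext_of_direction_eq h ⟨x, hx, hx'⟩)
  have hlt : l.direction < l.direction ⊔ l'.direction := by
    refine lt_of_le_of_ne le_sup_left fun h => hdir ?_
    refine (Submodule.eq_of_le_of_finrank_eq (left_eq_sup.1 h) ?_).symm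
    exact hl'.trans hl.symm
  have h1 := Submodule.finrank_lt_finrank_of_lt hlt
  have h2 := Submodule.finrank_add_le_finrank_add_finrank l.direction l'.direction
  rw [IsLine] at hl hl'
  omega

/-- A projection to the plane under which the directions of any two distinct intersecting lines
of a finite collection remain independent. -/
theorem exists_generic_projection (A : Finset (AffineSubspace ℝ Space3))
    (hA : ∀ l ∈ A, IsLine l) : ∃ π : Space3 →ₗ[ℝ] (Fin 2 → ℝ), ∀ l ∈ A, ∀ l' ∈ A, l ≠ l' →
      ∀ x, x ∈ l → x ∈ l' → l.direction.map π ⊔ l'.direction.map π = ⊤ := by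
  classical
  have hfin : Module.finrank ℝ Space3 = 3 := by simp
  set P : Finset (Submodule ℝ Space3) :=
    ((A ×ˢ A).image fun a => a.1.direction ⊔ a.2.direction) with hP
  have hmemP : ∀ l ∈ A, ∀ l' ∈ A, l.direction ⊔ l'.direction ∈ P := fun l hl l' hl' =>
    Finset.mem_image.2 ⟨(l, l'), Finset.mem_product.2 ⟨hl, hl'⟩, rfl⟩
  have htop : (⊤ : Submodule ℝ Space3) ∉ P := by
    intro h
    obtain ⟨⟨l, l'⟩, hll, heq⟩ := Finset.mem_image.1 h
    obtain ⟨hl, hl'⟩ := Finset.mem_product.1 hll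
    have h1 := Submodule.finrank_add_le_finrank_add_finrank l.direction l'.direction
    have h2 : Module.finrank ℝ l.direction = 1 := hA l hl
    have h3 : Module.finrank ℝ l'.direction = 1 := hA l' hl'
    have h4 : Module.finrank ℝ ↥(l.direction ⊔ l'.direction) = 3 := by
      rw [show l.direction ⊔ l'.direction = ⊤ from heq, finrank_top, hfin]
    omega
  -- Finitely many proper subspaces do not cover a real vector space. The projection is along a
  -- vector `w` outside all the spans of two directions.
  obtain ⟨w, hw⟩ := (Set.ne_univ_iff_exists_notMem _).1 (Subspace.biUnion_ne_univ_of_top_notMem htop)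
  simp only [Set.mem_iUnion, SetLike.mem_coe, not_exists] at hw
  by_cases hw0 : w = 0
  · refine ⟨0, fun l hl l' hl' => ?_⟩
    refine absurd ?_ (hw _ (hmemP l hl l' hl'))
    rw [hw0]
    exact Submodule.zero_mem _
  have hquot : Module.finrank ℝ (Space3 ⧸ Submodule.span ℝ {w}) =
      Module.finrank ℝ (Fin 2 → ℝ) := by
    have h := Submodule.finrank_quotient_add_finrank (Submodule.span ℝ {w})
    rw [finrank_span_singleton hw0, hfin] at h
    rw [Module.finrank_fin_fun]
    omega
  let e := LinearEquiv.ofFinrankEq _ _ hquot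
  refine ⟨e.toLinearMap ∘ₗ (Submodule.span ℝ {w}).mkQ, fun l hl l' hl' hne x hx hx' => ?_⟩
  have h2 := (hA l hl).finrank_sup_direction (hA l' hl') hne hx hx'
  have hwn := hw _ (hmemP l hl l' hl')
  have hlt : l.direction ⊔ l'.direction <
      l.direction ⊔ l'.direction ⊔ Submodule.span ℝ {w} := by
    refine lt_of_le_of_ne le_sup_left fun h => hwn ?_
    rw [h]
    exact Submodule.mem_sup_right (Submodule.mem_span_singleton_self w)
  have h3 := Submodule.finrank_lt_finrank_of_lt hlt
  have htop' : l.direction ⊔ l'.direction ⊔ Submodule.span ℝ {w} = ⊤ := by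
    refine Submodule.eq_top_of_finrank_eq (le_antisymm (Submodule.finrank_le _) ?_)
    omega
  have hmap : (Submodule.span ℝ {w}).map
      (e.toLinearMap ∘ₗ (Submodule.span ℝ {w}).mkQ) = ⊥ := by
    rw [Submodule.map_comp, Submodule.mkQ_map_self, Submodule.map_bot]
  have hrange : (⊤ : Submodule ℝ Space3).map
      (e.toLinearMap ∘ₗ (Submodule.span ℝ {w}).mkQ) = ⊤ := by
    rw [Submodule.map_comp, Submodule.map_top, Submodule.range_mkQ, Submodule.map_top,
      LinearEquiv.range]
  rw [← Submodule.map_sup, ← hrange, ← htop', Submodule.map_sup _ (Submodule.span ℝ {w}), hmap,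
    sup_bot_eq]

open Classical in
-- Inclusion–exclusion: two distinct points share at most one line, so a new point has at most
-- `Y.card` lines already counted.
theorem card_mul_le_card_lines_meeting (A : Finset (AffineSubspace ℝ Space3))
    (hA : ∀ l ∈ A, IsLine l) (k : ℕ) (Y : Finset Space3)
    (hY : ∀ y ∈ Y, k ≤ (A.filter (y ∈ ·)).card) :
    2 * (Y.card * k) ≤ 2 * (A.filter fun l => ∃ y ∈ Y, y ∈ l).card + Y.card ^ 2 := by
  induction Y using Finset.induction_on with
  | empty => simp
  | insert y Y hyY ih =>
    have h1 := ih fun z hz => hY z (Finset.mem_insert_of_mem hz)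
    have h2 := hY y (Finset.mem_insert_self y Y)
    have h3 : ((A.filter (y ∈ ·)).filter fun l => ∃ z ∈ Y, z ∈ l).card ≤ Y.card := by
      refine Finset.card_le_card_of_injOn
        (fun l => if h : ∃ z ∈ Y, z ∈ l then h.choose else y) ?_ ?_
      · intro l hl
        have h := (Finset.mem_filter.1 hl).2
        simp only [dif_pos h]
        exact h.choose_spec.1
      · intro l hl l' hl' heq
        obtain ⟨hl1, h⟩ := Finset.mem_filter.1 hl
        obtain ⟨hl1', h'⟩ := Finset.mem_filter.1 hl'
        rw [Finset.mem_filter] at hl1 hl1'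
        simp only [dif_pos h, dif_pos h'] at heq
        refine (hA l hl1.1).eq_of_mem_of_mem (hA l' hl1'.1) (x := y) (y := h.choose) ?_ hl1.2
          h.choose_spec.2 hl1'.2 (heq ▸ h'.choose_spec.2)
        rintro heq'
        exact hyY (heq' ▸ h.choose_spec.1)
    have h4 := Finset.card_filter_add_card_filter_not (s := A.filter (y ∈ ·))
      (fun l => ∃ z ∈ Y, z ∈ l)
    have h5 : ((A.filter (y ∈ ·)).filter fun l => ¬∃ z ∈ Y, z ∈ l).card +
        (A.filter fun l => ∃ z ∈ Y, z ∈ l).card ≤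
        (A.filter fun l => ∃ z ∈ insert y Y, z ∈ l).card := by
      rw [← Finset.card_union_of_disjoint]
      · refine Finset.card_le_card fun l hl => ?_
        rw [Finset.mem_union, Finset.mem_filter, Finset.mem_filter, Finset.mem_filter] at hl
        rw [Finset.mem_filter]
        rcases hl with ⟨⟨hl, hy⟩, -⟩ | ⟨hl, z, hz, hzl⟩
        · exact ⟨hl, y, Finset.mem_insert_self y Y, hy⟩
        · exact ⟨hl, z, Finset.mem_insert_of_mem hz, hzl⟩
      · rw [Finset.disjoint_left]
        intro l hl hl'
        exact (Finset.mem_filter.1 hl).2 (Finset.mem_filter.1 hl').2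
    rw [Finset.card_insert_of_notMem hyY]
    nlinarith

open Classical in
/-- Points in cells are few, if each cell contains few points compared to the lines meeting it and
each line meets few cells. -/
theorem card_le_of_cells {κ : Type*} [DecidableEq κ] (A : Finset (AffineSubspace ℝ Space3)) (Y : Finset Space3)
    (cell : Space3 → κ) (D : ℕ) {r : ℝ} (hr : 0 ≤ r)
    (hline : ∀ l ∈ A, ((Y.filter (· ∈ l)).image cell).card ≤ D + 1)
    (hcell : ∀ σ, ((Y.filter (cell · = σ)).card : ℝ) ≤
      r * (A.filter fun l => ∃ y ∈ Y.filter (cell · = σ), y ∈ l).card) :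
    (Y.card : ℝ) ≤ r * ((D + 1) * A.card) := by
  have h1 : (Y.card : ℝ) = ∑ σ ∈ Y.image cell, ((Y.filter (cell · = σ)).card : ℝ) := by
    rw [Finset.card_eq_sum_card_image cell Y]
    push_cast
    rfl
  -- Double counting of the pairs of a cell and a line meeting it.
  have h2 : ∑ σ ∈ Y.image cell, (A.filter fun l => ∃ y ∈ Y.filter (cell · = σ), y ∈ l).card ≤
      A.card * (D + 1) := by
    have h := Finset.sum_card_bipartiteAbove_eq_sum_card_bipartiteBelow
      (s := Y.image cell) (t := A) fun σ l => ∃ y ∈ Y.filter (cell · = σ), y ∈ l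
    unfold Finset.bipartiteAbove Finset.bipartiteBelow at h
    rw [h]
    refine Finset.sum_le_card_nsmul _ _ _ fun l hl => le_trans (Finset.card_le_card ?_) (hline l hl)
    intro σ hσ
    obtain ⟨-, y, hy, hyl⟩ := Finset.mem_filter.1 hσ
    obtain ⟨hyY, rfl⟩ := Finset.mem_filter.1 hy
    exact Finset.mem_image_of_mem _ (Finset.mem_filter.2 ⟨hyY, hyl⟩)
  rw [h1]
  calc _ ≤ ∑ σ ∈ Y.image cell,
        r * ((A.filter fun l => ∃ y ∈ Y.filter (cell · = σ), y ∈ l).card : ℝ) :=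
        Finset.sum_le_sum fun σ _ => hcell σ
    _ = r * ((∑ σ ∈ Y.image cell,
        (A.filter fun l => ∃ y ∈ Y.filter (cell · = σ), y ∈ l).card : ℕ) : ℝ) := by
        rw [← Finset.mul_sum]
        push_cast
        rfl
    _ ≤ r * ((A.card * (D + 1) : ℕ) : ℝ) := by gcongr
    _ = r * ((D + 1) * A.card) := by push_cast; ring

end LineIncidence

/-! ### The Szemerédi–Trotter bound. -/

section RichPoints

open Classical in
theorem choose_two_le_card_spanningSubsets {A : Finset (AffineSubspace ℝ Space3)}
    {π : Space3 →ₗ[ℝ] (Fin 2 → ℝ)}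
    (hπ : ∀ l ∈ A, ∀ l' ∈ A, l ≠ l' → ∀ x, x ∈ l → x ∈ l' →
      l.direction.map π ⊔ l'.direction.map π = ⊤) (x : Space3) :
    (A.filter (x ∈ ·)).card.choose 2 ≤ (spanningSubsets π A x).card := by
  rw [← Finset.card_powersetCard]
  refine Finset.card_le_card fun T hT => ?_
  obtain ⟨hTA, hcard⟩ := Finset.mem_powersetCard.1 hT
  have hx : ∀ l ∈ T, x ∈ l := fun l hl => (Finset.mem_filter.1 (hTA hl)).2
  have hA : ∀ l ∈ T, l ∈ A := fun l hl => (Finset.mem_filter.1 (hTA hl)).1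
  refine mem_spanningSubsets.2 ⟨hA, hcard, hx, ?_⟩
  obtain ⟨l, l', hne, rfl⟩ := Finset.card_eq_two.1 hcard
  rw [Finset.iSup_insert, Finset.iSup_singleton]
  exact hπ l (hA l (by simp)) l' (hA l' (by simp)) hne x (hx l (by simp)) (hx l' (by simp))

open Classical in
/-- The **Szemerédi–Trotter theorem** for points lying on about `k` of finitely many lines. -/
theorem exists_card_rich_points_le : ∃ B : ℝ, 0 < B ∧
    ∀ A : Finset (AffineSubspace ℝ Space3), (∀ l ∈ A, IsLine l) → ∀ k : ℕ, 2 ≤ k →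
    ∀ X : Finset Space3,
    (∀ x ∈ X, k ≤ (A.filter (x ∈ ·)).card ∧ (A.filter (x ∈ ·)).card ≤ 2 * k) →
      (X.card : ℝ) ≤ B * ((A.card : ℝ) ^ 2 / (k : ℝ) ^ 3 + (A.card : ℝ) / k) := by
  obtain ⟨C, hC, hpart⟩ := exists_polynomial_partition (n := 2) (by norm_num)
  refine ⟨288 * C ^ 2, by positivity, fun A hA k hk X hX => ?_⟩
  obtain ⟨π, hπ⟩ := exists_generic_projection A hA
  have hexJ : ∃ J : ℕ, X.card ≤ k * 2 ^ J :=
    ⟨X.card, Nat.lt_two_pow_self.le.trans (Nat.le_mul_of_pos_left _ (by omega))⟩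
  -- The fewest bisections that leave at most `k` points per cell. The quadratic loss in
  -- inclusion–exclusion is then absorbed, giving s * k ≤ 2 * m for s points and m lines.
  set J := Nat.find hexJ with hJdef
  have hJ : X.card ≤ k * 2 ^ J := Nat.find_spec hexJ
  obtain ⟨p, D, cell, hp0, hpD, hD, hcell, hline⟩ := hpart π X J
  set Q : ℝ := ((2 : ℝ) ^ (1 / (2 : ℕ) : ℝ)) ^ J with hQ
  have hQ1 : 1 ≤ Q := one_le_pow₀ (Real.one_le_rpow (by norm_num) (by norm_num))
  have hQ2 : Q ^ 2 = 2 ^ J := by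
    rw [hQ, ← pow_mul, mul_comm J 2, pow_mul, one_div, Real.rpow_inv_natCast_pow (by norm_num)
      (by norm_num)]
  have hk0 : (0 : ℝ) < k := by positivity
  set L : ℝ := (A.card : ℝ) with hL
  have hL0 : 0 ≤ L := Nat.cast_nonneg _
  set Y := X.filter fun x => MvPolynomial.eval (π x) p ≠ 0 with hY
  set Z := X.filter fun x => ¬MvPolynomial.eval (π x) p ≠ 0 with hZ
  have hYZ : Y.card + Z.card = X.card := Finset.card_filter_add_card_filter_not _
  have hYbound : (Y.card : ℝ) * k ≤ 2 * ((D + 1) * L) := by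
    have h := card_le_of_cells A Y cell D (r := 2 / k) (by positivity)
      (fun l hl => hline l (hA l hl) _ fun y hy => by
        obtain ⟨hy, hyl⟩ := Finset.mem_filter.1 hy
        exact ⟨hyl, (Finset.mem_filter.1 hy).2⟩)
      (fun σ => by
        have h1 := hcell σ
        rw [← Finset.filter_filter, ← hY] at h1
        have h2 : (Y.filter (cell · = σ)).card ≤ k := by
          have : 2 ^ J * (Y.filter (cell · = σ)).card ≤ 2 ^ J * k := by
            rw [mul_comm _ k]
            exact h1.trans hJ
          exact Nat.le_of_mul_le_mul_left this (by positivity)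
        have h3 := card_mul_le_card_lines_meeting A hA k (Y.filter (cell · = σ)) fun y hy =>
          (hX y (Finset.mem_filter.1 (Finset.mem_filter.1 hy).1).1).1
        have h4 : (Y.filter (cell · = σ)).card * k ≤
            2 * (A.filter fun l => ∃ y ∈ Y.filter (cell · = σ), y ∈ l).card := by nlinarith
        rw [div_mul_eq_mul_div, le_div_iff₀ hk0]
        exact_mod_cast h4)
    rw [div_mul_eq_mul_div, le_div_iff₀ hk0] at h
    exact h
  have hZbound : (Z.card : ℝ) * k ≤ 8 * (D * L) := by
    have h := sum_card_spanningSubsets_le (K := 2 * k) hA (X := Z) hp0 hpD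
      (fun x hx => not_not.1 (Finset.mem_filter.1 hx).2)
      (fun x hx l _ => (card_spanningSubsets_filter_mem_le π A x l).trans <| by
        simpa using (hX x (Finset.mem_filter.1 hx).1).2)
    -- After the generic projection every pair of lines through a point spans, so each point of `Z`
    -- counts at least `k.choose 2` times.
    have h1 : Z.card * k.choose 2 ≤ ∑ x ∈ Z, (spanningSubsets π A x).card := by
      rw [← smul_eq_mul]
      refine Finset.card_nsmul_le_sum _ _ _ fun x hx => ?_
      exact (Nat.choose_le_choose 2 (hX x (Finset.mem_filter.1 hx).1).1).trans
        (choose_two_le_card_spanningSubsets hπ x)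
    have h2 : (Z.card : ℝ) * (k.choose 2 : ℝ) ≤ 2 * k * D * L := by
      rw [hL]
      exact_mod_cast h1.trans h
    rw [Nat.cast_choose_two] at h2
    have hk2 : (2 : ℝ) ≤ k := by exact_mod_cast hk
    have h3 : (Z.card : ℝ) * (k - 1) ≤ 4 * (D * L) := by
      have : k * ((Z.card : ℝ) * (k - 1)) ≤ k * (4 * (D * L)) := by linarith
      exact le_of_mul_le_mul_left this hk0
    have h4 : (0 : ℝ) ≤ Z.card := Nat.cast_nonneg _
    nlinarith
  have hX0 : (0 : ℝ) ≤ X.card := Nat.cast_nonneg _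
  have hmain : (X.card : ℝ) * k ≤ 12 * C * Q * L := by
    have h : (X.card : ℝ) = Y.card + Z.card := by exact_mod_cast hYZ.symm
    have hCQ : 1 ≤ C * Q := one_le_mul_of_one_le_of_one_le hC hQ1
    have h5 : (D : ℝ) * L ≤ C * Q * L := by gcongr
    have h6 : L ≤ C * Q * L := le_mul_of_one_le_left hL0 hCQ
    rw [h]
    linarith
  rcases Nat.eq_zero_or_pos J with hJ0 | hJpos
  · have hQ' : Q = 1 := by rw [hQ, hJ0, pow_zero]
    rw [hQ', mul_one] at hmain
    have h1 : (X.card : ℝ) ≤ 12 * C * (L / k) := by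
      rw [← mul_div_assoc, le_div_iff₀ hk0]
      exact hmain
    have h2 : (0 : ℝ) ≤ L ^ 2 / (k : ℝ) ^ 3 := by positivity
    have h3 : (0 : ℝ) ≤ L / k := by positivity
    calc (X.card : ℝ) ≤ 12 * C * (L / k) := h1
      _ ≤ 288 * C ^ 2 * (L / k) := mul_le_mul_of_nonneg_right (by nlinarith) h3
      _ ≤ _ := by
        gcongr
        linarith
  -- Minimality of `J` bounds `k * Q ^ 2` by `2 * X.card`. Squaring `hmain` and inserting this
  -- cancels one factor `X.card`.
  · have hlt : k * 2 ^ (J - 1) < X.card := not_le.1 (Nat.find_min hexJ (by omega))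
    have hlt' : (k : ℝ) * Q ^ 2 ≤ 2 * X.card := by
      have h1 : k * 2 ^ J ≤ 2 * X.card := by
        rw [show J = J - 1 + 1 by omega, pow_succ]
        linarith
      rw [hQ2]
      exact_mod_cast h1
    have hXpos : (0 : ℝ) < X.card := by
      exact_mod_cast lt_of_le_of_lt (Nat.zero_le _) hlt
    have h1 : ((X.card : ℝ) * k) ^ 2 ≤ (12 * C * Q * L) ^ 2 := by gcongr
    have h2 : (X.card : ℝ) * ((X.card : ℝ) * k ^ 3) ≤ (X.card : ℝ) * (288 * C ^ 2 * L ^ 2) := by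
      calc (X.card : ℝ) * ((X.card : ℝ) * k ^ 3) = k * ((X.card : ℝ) * k) ^ 2 := by ring
        _ ≤ k * (12 * C * Q * L) ^ 2 := by gcongr
        _ = 144 * C ^ 2 * L ^ 2 * (k * Q ^ 2) := by ring
        _ ≤ 144 * C ^ 2 * L ^ 2 * (2 * X.card) := by gcongr
        _ = _ := by ring
    have h3 := le_of_mul_le_mul_left h2 hXpos
    have h4 : (X.card : ℝ) ≤ 288 * C ^ 2 * (L ^ 2 / k ^ 3) := by
      rw [← mul_div_assoc, le_div_iff₀ (by positivity)]
      exact h3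
    refine h4.trans ?_
    gcongr
    have : (0 : ℝ) ≤ L / k := by positivity
    linarith

end RichPoints

/-! ### The partition bound for joints with multiplicity. -/

section Multiplicity

/-- The identification of `Space3` with coordinate space. -/
noncomputable def coordinateMap : Space3 →ₗ[ℝ] (Fin 3 → ℝ) :=
  (WithLp.linearEquiv 2 ℝ (Fin 3 → ℝ)).toLinearMap

theorem iSup_map_coordinateMap_eq_top_iff (T : Finset (AffineSubspace ℝ Space3)) :
    ⨆ l ∈ T, l.direction.map coordinateMap = ⊤ ↔ DirectionsSpan T := by
  have hmap : ⨆ l ∈ T, l.direction.map coordinateMap =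
      (⨆ l ∈ T, l.direction).map coordinateMap := by
    simp only [Submodule.map_iSup]
  have htop : (⊤ : Submodule ℝ Space3).map coordinateMap = ⊤ := by
    rw [Submodule.map_top, coordinateMap, LinearEquiv.range]
  have hinj : Function.Injective coordinateMap := (WithLp.linearEquiv 2 ℝ (Fin 3 → ℝ)).injective
  rw [hmap, DirectionsSpan]
  constructor
  · intro h
    exact Submodule.map_injective_of_injective hinj (h.trans htop.symm)
  · intro h
    rw [h, htop]

theorem jointMultiplicity_eq_card (A : Finset (AffineSubspace ℝ Space3)) (x : Space3) :
    jointMultiplicity A x = (spanningSubsets coordinateMap A x).card := by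
  rw [jointMultiplicity, ← Set.ncard_coe_finset]
  congr 1
  ext T
  rw [Finset.mem_coe, mem_spanningSubsets, iSup_map_coordinateMap_eq_top_iff]
  rfl

open Classical in
theorem linesThrough_eq_card (A : Finset (AffineSubspace ℝ Space3)) (x : Space3) :
    linesThrough A x = (A.filter (x ∈ ·)).card := by
  rw [linesThrough, ← Set.ncard_coe_finset]
  congr 1
  ext l
  simp

open Classical in
theorem card_spanningSubsets_le {n : ℕ} (π : Space3 →ₗ[ℝ] (Fin n → ℝ))
    (A : Finset (AffineSubspace ℝ Space3)) (x : Space3) :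
    (spanningSubsets π A x).card ≤ (A.filter (x ∈ ·)).card ^ n := by
  refine le_trans ?_ (Nat.choose_le_pow (A.filter (x ∈ ·)).card n)
  rw [← Finset.card_powersetCard]
  refine Finset.card_le_card fun T hT => ?_
  obtain ⟨hTA, hcard, hx, -⟩ := mem_spanningSubsets.1 hT
  exact Finset.mem_powersetCard.2 ⟨fun l hl => Finset.mem_filter.2 ⟨hTA hl, hx l hl⟩, hcard⟩

theorem finite_setOf_isJoint (A : Finset (AffineSubspace ℝ Space3)) (hA : ∀ l ∈ A, IsLine l) :
    {x | IsJoint A x}.Finite := by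
  classical
  refine Set.Finite.subset (Set.Finite.biUnion (A ×ˢ A).finite_toSet
    (t := fun a => {x : Space3 | a.1 ≠ a.2 ∧ x ∈ a.1 ∧ x ∈ a.2}) fun a ha => ?_) ?_
  · refine Set.Subsingleton.finite fun x hx y hy => ?_
    by_contra hxy
    obtain ⟨h1, h2⟩ := Finset.mem_product.1 (Finset.mem_coe.1 ha)
    exact hx.1 ((hA _ h1).eq_of_mem_of_mem (hA _ h2) hxy hx.2.1 hy.2.1 hx.2.2 hy.2.2)
  · rintro x ⟨T, hTA, hcard, hx, -⟩
    obtain ⟨l, hl, l', hl', hne⟩ := Finset.one_lt_card.1 (show 1 < T.card by omega)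
    refine Set.mem_iUnion₂.2 ⟨(l, l'), ?_, hne, hx l hl, hx l' hl'⟩
    exact Finset.mem_coe.2 (Finset.mem_product.2 ⟨hTA hl, hTA hl'⟩)

open Classical in
/-- Polynomial partitioning with `2 ^ J` cells bounds the number of points of large multiplicity
on about `k` lines. -/
theorem exists_card_le_of_partition : ∃ B : ℝ, 0 < B ∧
    ∀ A : Finset (AffineSubspace ℝ Space3), (∀ l ∈ A, IsLine l) → ∀ N k : ℕ, 1 ≤ N → 2 ≤ k →
    N ≤ 8 * k ^ 3 → ∀ X : Finset Space3,
    (∀ x ∈ X, k ≤ (A.filter (x ∈ ·)).card ∧ (A.filter (x ∈ ·)).card ≤ 2 * k ∧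
      N ≤ (spanningSubsets coordinateMap A x).card) → ∀ J : ℕ,
      (X.card : ℝ) ≤ B * (k ^ 2 * ((2 : ℝ) ^ (1 / (3 : ℕ) : ℝ)) ^ J * A.card / N) ∨
      (X.card : ℝ) ≤ B * (A.card ^ 2 / (((2 : ℝ) ^ (1 / (3 : ℕ) : ℝ)) ^ J * k ^ 3)) := by
  obtain ⟨C, hC, hpart⟩ := exists_polynomial_partition (n := 3) (by norm_num)
  obtain ⟨B, hB, hrich⟩ := exists_card_rich_points_le
  refine ⟨64 * B * C + 8 * C + 32 * B * C ^ 2, by positivity,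
    fun A hA N k hN hk hNk X hX J => ?_⟩
  obtain ⟨p, D, cell, hp0, hpD, hD, hcell, hline⟩ := hpart coordinateMap X J
  set Q : ℝ := ((2 : ℝ) ^ (1 / (3 : ℕ) : ℝ)) ^ J with hQ
  have hQ1 : 1 ≤ Q := one_le_pow₀ (Real.one_le_rpow (by norm_num) (by norm_num))
  have hQ3 : Q ^ 3 = 2 ^ J := by
    rw [hQ, ← pow_mul, mul_comm J 3, pow_mul, one_div, Real.rpow_inv_natCast_pow (by norm_num)
      (by norm_num)]
  have hk0 : (0 : ℝ) < k := by positivity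
  have hN0 : (0 : ℝ) < N := by positivity
  set L : ℝ := (A.card : ℝ) with hL
  have hL0 : 0 ≤ L := Nat.cast_nonneg _
  set S : ℝ := (X.card : ℝ) with hS
  have hS0 : 0 ≤ S := Nat.cast_nonneg _
  set Y := X.filter fun x => MvPolynomial.eval (coordinateMap x) p ≠ 0 with hY
  set Z := X.filter fun x => ¬MvPolynomial.eval (coordinateMap x) p ≠ 0 with hZ
  have hYZ : (Y.card : ℝ) + Z.card = S := by
    rw [hS, ← Finset.card_filter_add_card_filter_not (s := X)
      fun x => MvPolynomial.eval (coordinateMap x) p ≠ 0, ← hY, ← hZ, Nat.cast_add]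
  -- The slope from the geometric mean of s ≤ S/Q³ and s ≤ 2Bm²/k³.
  set ρ : ℝ := √(2 * B * S / (Q ^ 3 * k ^ 3)) with hρ
  have hρ0 : 0 ≤ ρ := Real.sqrt_nonneg _
  have hYbound : (Y.card : ℝ) ≤ (2 * B / k + ρ) * ((D + 1) * L) := by
    refine card_le_of_cells A Y cell D (by positivity)
      (fun l hl => hline l (hA l hl) _ fun y hy => ?_) (fun σ => ?_)
    · obtain ⟨hy, hyl⟩ := Finset.mem_filter.1 hy
      exact ⟨hyl, (Finset.mem_filter.1 hy).2⟩
    · have h1 := hcell σ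
      rw [← Finset.filter_filter, ← hY] at h1
      set W := Y.filter (cell · = σ) with hW
      set A' := A.filter fun l => ∃ y ∈ W, y ∈ l with hA'
      have hWX : ∀ w ∈ W, w ∈ X := fun w hw =>
        (Finset.mem_filter.1 (Finset.mem_filter.1 hw).1).1
      have h2 := hrich A' (fun l hl => hA l (Finset.mem_filter.1 hl).1) k hk W fun w hw => by
        -- Every line through a point of the cell meets the cell, so restricting to these lines
        -- preserves richness.
        have heq : A'.filter (w ∈ ·) = A.filter (w ∈ ·) := by
          ext l
          simp only [hA', Finset.mem_filter]
          exact ⟨fun h => ⟨h.1.1, h.2⟩, fun h => ⟨⟨h.1, w, hw, h.2⟩, h.2⟩⟩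
        rw [heq]
        exact ⟨(hX w (hWX w hw)).1, (hX w (hWX w hw)).2.1⟩
      have h3 : Q ^ 3 * (W.card : ℝ) ≤ S := by
        rw [hQ3, hS]
        exact_mod_cast h1
      set s : ℝ := (W.card : ℝ)
      set m : ℝ := (A'.card : ℝ)
      have hs0 : 0 ≤ s := Nat.cast_nonneg _
      have hm0 : 0 ≤ m := Nat.cast_nonneg _
      rcases le_total (m ^ 2 / (k : ℝ) ^ 3) (m / k) with hle | hle
      · calc s ≤ B * (m ^ 2 / (k : ℝ) ^ 3 + m / k) := h2
          _ ≤ B * (m / k + m / k) := by gcongr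
          _ = 2 * B / k * m := by ring
          _ ≤ (2 * B / k + ρ) * m := by
            gcongr
            linarith
      · have h4 : s ≤ 2 * B * m ^ 2 / (k : ℝ) ^ 3 := by
          calc s ≤ B * (m ^ 2 / (k : ℝ) ^ 3 + m / k) := h2
            _ ≤ B * (m ^ 2 / (k : ℝ) ^ 3 + m ^ 2 / (k : ℝ) ^ 3) := by gcongr
            _ = 2 * B * m ^ 2 / (k : ℝ) ^ 3 := by ring
        have h5 : s ≤ S / Q ^ 3 := by
          rw [le_div_iff₀ (by positivity)]
          linarith
        have h6 : s ≤ √(2 * B * S / (Q ^ 3 * k ^ 3) * m ^ 2) := by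
          refine Real.le_sqrt_of_sq_le ?_
          calc s ^ 2 = s * s := sq s
            _ ≤ S / Q ^ 3 * (2 * B * m ^ 2 / (k : ℝ) ^ 3) := by gcongr
            _ = _ := by field_simp
        rw [Real.sqrt_mul (by positivity), Real.sqrt_sq hm0] at h6
        refine h6.trans ?_
        gcongr
        have : 0 ≤ 2 * B / k := by positivity
        linarith
  have hZbound : (Z.card : ℝ) * N ≤ 4 * k ^ 2 * D * L := by
    have h := sum_card_spanningSubsets_le (K := (2 * k) ^ 2) hA (X := Z) hp0 hpD
      (fun x hx => not_not.1 (Finset.mem_filter.1 hx).2)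
      (fun x hx l _ => (card_spanningSubsets_filter_mem_le coordinateMap A x l).trans <|
        Nat.pow_le_pow_left (hX x (Finset.mem_filter.1 hx).1).2.1 2)
    have h1 : Z.card * N ≤ ∑ x ∈ Z, (spanningSubsets coordinateMap A x).card := by
      rw [← smul_eq_mul]
      exact Finset.card_nsmul_le_sum _ _ _ fun x hx => (hX x (Finset.mem_filter.1 hx).1).2.2
    have h2 : (Z.card : ℝ) * N ≤ (2 * k) ^ 2 * D * L := by
      rw [hL]
      exact_mod_cast h1.trans h
    linarith
  have hD1 : (D : ℝ) + 1 ≤ 2 * C * Q := by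
    have := one_le_mul_of_one_le_of_one_le hC hQ1
    linarith
  have hZ' : (Z.card : ℝ) ≤ 4 * C * (k ^ 2 * Q * L / N) := by
    rw [← mul_div_assoc, le_div_iff₀ hN0]
    calc (Z.card : ℝ) * N ≤ 4 * k ^ 2 * D * L := hZbound
      _ ≤ 4 * k ^ 2 * (C * Q) * L := by gcongr
      _ = _ := by ring
  have hY' : (Y.card : ℝ) ≤ 32 * B * C * (k ^ 2 * Q * L / N) + ρ * (2 * C * Q * L) := by
    -- Here `N ≤ 8 * k ^ 3` lets the surface bound absorb the linear Szemerédi–Trotter term.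
    have h1 : (1 : ℝ) / k ≤ 8 * (k ^ 2 / N) := by
      rw [← mul_div_assoc, div_le_div_iff₀ hk0 hN0]
      have : (N : ℝ) ≤ 8 * k ^ 3 := by exact_mod_cast hNk
      nlinarith
    calc (Y.card : ℝ) ≤ (2 * B / k + ρ) * ((D + 1) * L) := hYbound
      _ ≤ (2 * B / k + ρ) * (2 * C * Q * L) := by gcongr
      _ = 4 * B * C * Q * L * (1 / k) + ρ * (2 * C * Q * L) := by ring
      _ ≤ 4 * B * C * Q * L * (8 * (k ^ 2 / N)) + ρ * (2 * C * Q * L) := by gcongr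
      _ = _ := by ring
  have hE0 : 0 ≤ k ^ 2 * Q * L / N := by positivity
  -- The larger of the two terms accounts for at least half of `S`. If it is the one with `ρ`, the
  -- factor √S in `ρ` is cancelled by squaring.
  rcases le_total (ρ * (2 * C * Q * L)) ((32 * B * C + 4 * C) * (k ^ 2 * Q * L / N)) with hle | hle
  · left
    calc S ≤ (64 * B * C + 8 * C) * (k ^ 2 * Q * L / N) := by linarith
      _ ≤ _ := by
        refine mul_le_mul_of_nonneg_right ?_ hE0
        have : 0 ≤ 32 * B * C ^ 2 := by positivity
        linarith
  · right
    have h1 : S ≤ 2 * (ρ * (2 * C * Q * L)) := by linarith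
    have hρ2 : ρ ^ 2 = 2 * B * S / (Q ^ 3 * k ^ 3) := Real.sq_sqrt (by positivity)
    have hF0 : 0 ≤ L ^ 2 / (Q * (k : ℝ) ^ 3) := by positivity
    have h2 : S ≤ 32 * B * C ^ 2 * (L ^ 2 / (Q * k ^ 3)) := by
      rcases hS0.eq_or_lt with h0 | hpos
      · rw [← h0]
        positivity
      · refine le_of_mul_le_mul_left ?_ hpos
        calc S * S ≤ (2 * (ρ * (2 * C * Q * L))) * (2 * (ρ * (2 * C * Q * L))) := by gcongr
          _ = 16 * C ^ 2 * Q ^ 2 * L ^ 2 * ρ ^ 2 := by ring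
          _ = S * (32 * B * C ^ 2 * (L ^ 2 / (Q * k ^ 3))) := by
            rw [hρ2]
            field_simp
            ring
    refine h2.trans (mul_le_mul_of_nonneg_right ?_ hF0)
    have : 0 ≤ 64 * B * C + 8 * C := by positivity
    linarith

/-- Choosing the number of cells in the partition bound. -/
theorem mul_le_of_partition_bounds {B C S a b n q : ℝ} (hB : 0 < B) (hC : 0 < C) (ha0 : 0 ≤ a)
    (hb0 : 0 < b) (hn0 : 0 < n) (hq1 : 1 < q) (hq2 : q ≤ 2)
    (hs : S ≤ B * ((a ^ 2) ^ 2 / (b ^ 2) ^ 3 + a ^ 2 / b ^ 2))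
    (hJ : ∀ J : ℕ, S ≤ C * ((b ^ 2) ^ 2 * q ^ J * a ^ 2 / n ^ 2) ∨
      S ≤ C * ((a ^ 2) ^ 2 / (q ^ J * (b ^ 2) ^ 3))) :
    S * n ≤ (B + 2 * C) * (a ^ 3 / b + a ^ 2 / b ^ 2 * n) := by
  have hT1 : 0 ≤ a ^ 3 / b := by positivity
  have hT2 : 0 ≤ a ^ 2 / b ^ 2 * n := by positivity
  -- With a = √L, b = √k and n = √N, the quantity a * n / b ^ 5 is the value of Q balancing the
  -- alternatives in `hJ`. Below 1 no partition is needed.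
  rcases lt_or_ge (a * n / b ^ 5) 1 with hlt | hge
  · rw [div_lt_one (by positivity)] at hlt
    have h1 : (a ^ 2) ^ 2 / (b ^ 2) ^ 3 * n ≤ a ^ 3 / b := by
      rw [div_mul_eq_mul_div, div_le_div_iff₀ (by positivity) hb0]
      calc (a ^ 2) ^ 2 * n * b = a ^ 3 * b * (a * n) := by ring
        _ ≤ a ^ 3 * b * b ^ 5 := by gcongr
        _ = _ := by ring
    calc S * n ≤ B * ((a ^ 2) ^ 2 / (b ^ 2) ^ 3 + a ^ 2 / b ^ 2) * n := by gcongr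
      _ = B * ((a ^ 2) ^ 2 / (b ^ 2) ^ 3 * n + a ^ 2 / b ^ 2 * n) := by ring
      _ ≤ B * (a ^ 3 / b + a ^ 2 / b ^ 2 * n) := by gcongr
      _ ≤ _ := by
        gcongr
        linarith
  -- Using `J + 1` puts the power of `q` above the balance point by a factor of at most `q ≤ 2`.
  · obtain ⟨J, hJ1, hJ2⟩ := exists_nat_pow_near hge hq1
    have hQ0 : 0 < q ^ (J + 1) := by positivity
    have hQ : q ^ (J + 1) ≤ 2 * (a * n / b ^ 5) := by
      rw [pow_succ]
      nlinarith
    have ha' : 0 < a := by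
      refine lt_of_le_of_ne ha0 ?_
      rintro h
      rw [← h] at hge
      norm_num at hge
    have hfinal : S * n ≤ 2 * C * (a ^ 3 / b) := by
      rcases hJ (J + 1) with h | h
      · calc S * n ≤ C * ((b ^ 2) ^ 2 * q ^ (J + 1) * a ^ 2 / n ^ 2) * n := by gcongr
          _ ≤ C * ((b ^ 2) ^ 2 * (2 * (a * n / b ^ 5)) * a ^ 2 / n ^ 2) * n := by gcongr
          _ = 2 * C * (a ^ 3 / b) := by
            field_simp
      · calc S * n ≤ C * ((a ^ 2) ^ 2 / (q ^ (J + 1) * (b ^ 2) ^ 3)) * n := by gcongr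
          _ ≤ C * ((a ^ 2) ^ 2 / (a * n / b ^ 5 * (b ^ 2) ^ 3)) * n := by gcongr
          _ = C * (a ^ 3 / b) := by
            field_simp
          _ ≤ 2 * C * (a ^ 3 / b) := by
            gcongr
            linarith
    refine hfinal.trans ?_
    calc 2 * C * (a ^ 3 / b) ≤ (B + 2 * C) * (a ^ 3 / b) := by
          gcongr
          linarith
      _ ≤ _ := by
        gcongr
        linarith

open Classical in
theorem exists_card_mul_sqrt_le : ∃ c : ℝ, 0 < c ∧
    ∀ A : Finset (AffineSubspace ℝ Space3), (∀ l ∈ A, IsLine l) → ∀ N k : ℕ, 1 ≤ N → 2 ≤ k →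
    N ≤ 8 * k ^ 3 → ∀ X : Finset Space3,
    (∀ x ∈ X, k ≤ (A.filter (x ∈ ·)).card ∧ (A.filter (x ∈ ·)).card ≤ 2 * k ∧
      N ≤ (spanningSubsets coordinateMap A x).card) →
      (X.card : ℝ) * √N ≤ c * (√A.card ^ 3 / √k + A.card / k * √N) := by
  obtain ⟨B, hB, hrich⟩ := exists_card_rich_points_le
  obtain ⟨C, hC, hpart⟩ := exists_card_le_of_partition
  refine ⟨B + 2 * C, by positivity, fun A hA N k hN hk hNk X hX => ?_⟩
  have hkR : (0 : ℝ) < k := by positivity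
  have hNR : (0 : ℝ) < N := by positivity
  have hs := hrich A hA k hk X fun x hx => ⟨(hX x hx).1, (hX x hx).2.1⟩
  have hJ := hpart A hA N k hN hk hNk X hX
  have ha0 : 0 ≤ √(A.card : ℝ) := Real.sqrt_nonneg _
  have hb0 : 0 < √(k : ℝ) := Real.sqrt_pos.2 hkR
  have hn0 : 0 < √(N : ℝ) := Real.sqrt_pos.2 hNR
  have ha : (A.card : ℝ) = √(A.card : ℝ) ^ 2 := (Real.sq_sqrt (Nat.cast_nonneg _)).symm
  have hb : (k : ℝ) = √(k : ℝ) ^ 2 := (Real.sq_sqrt (Nat.cast_nonneg _)).symm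
  have hn : (N : ℝ) = √(N : ℝ) ^ 2 := (Real.sq_sqrt (Nat.cast_nonneg _)).symm
  -- With the square roots as variables, all half-integer powers become integer powers.
  generalize √(A.card : ℝ) = a at *
  generalize √(k : ℝ) = b at *
  generalize √(N : ℝ) = n at *
  rw [ha, hb] at hs ⊢
  simp only [ha, hb, hn] at hJ
  have hq2 : (2 : ℝ) ^ (1 / (3 : ℕ) : ℝ) ≤ 2 :=
    calc (2 : ℝ) ^ (1 / (3 : ℕ) : ℝ) ≤ (2 : ℝ) ^ (1 : ℝ) :=
          Real.rpow_le_rpow_of_exponent_le (by norm_num) (by norm_num)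
      _ = 2 := Real.rpow_one 2
  exact mul_le_of_partition_bounds hB hC ha0 hb0 hn0
    (Real.one_lt_rpow (by norm_num) (by norm_num)) hq2 hs hJ

end Multiplicity

/-! ### The bound for joints. -/

theorem proposition1p2 :
    ∃ c : ℝ, ∀ (A : Finset (AffineSubspace ℝ Space3)), (∀ l ∈ A, IsLine l) →
      ∀ N k : ℕ, 1 ≤ k →
        (jointsNK A N k).Finite ∧
        ((jointsNK A N k).ncard : ℝ) * (N : ℝ) ^ (1 / 2 : ℝ) ≤
          c * ((A.card : ℝ) ^ (3 / 2 : ℝ) / (k : ℝ) ^ (1 / 2 : ℝ) +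
            (A.card : ℝ) / (k : ℝ) * (N : ℝ) ^ (1 / 2 : ℝ)) := by
  classical
  obtain ⟨c, hc, hbound⟩ := exists_card_mul_sqrt_le
  refine ⟨c, fun A hA N k hk => ?_⟩
  have hfin : (jointsNK A N k).Finite := (finite_setOf_isJoint A hA).subset fun x hx => hx.1
  refine ⟨hfin, ?_⟩
  rcases (jointsNK A N k).eq_empty_or_nonempty with hempty | ⟨x, hx⟩
  · rw [hempty, Set.ncard_empty, Nat.cast_zero, zero_mul]
    positivity
  have hlines (y : Space3) (hy : y ∈ jointsNK A N k) :
      k ≤ (A.filter (y ∈ ·)).card ∧ (A.filter (y ∈ ·)).card < 2 * k := by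
    have h := hy.2.2
    rwa [linesThrough_eq_card] at h
  have hmult (y : Space3) (hy : y ∈ jointsNK A N k) :
      N ≤ (spanningSubsets coordinateMap A y).card ∧
        (spanningSubsets coordinateMap A y).card < 2 * N := by
    have h := hy.2.1
    rwa [jointMultiplicity_eq_card] at h
  -- A multiplicity below `2 * N` excludes `N = 0`. Likewise a joint lies on at least three and
  -- fewer than `2 * k` lines, which excludes `k = 1`.
  have hN : 1 ≤ N := by
    have := hmult x hx
    omega
  have hk2 : 2 ≤ k := by
    obtain ⟨T, hTA, hcard, hxT, -⟩ := hx.1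
    have h1 : T.card ≤ (A.filter (x ∈ ·)).card :=
      Finset.card_le_card fun l hl => Finset.mem_filter.2 ⟨hTA hl, hxT l hl⟩
    have := hlines x hx
    omega
  have hNk : N ≤ 8 * k ^ 3 :=
    calc N ≤ (A.filter (x ∈ ·)).card ^ 3 :=
          (hmult x hx).1.trans (card_spanningSubsets_le coordinateMap A x)
      _ ≤ (2 * k) ^ 3 := Nat.pow_le_pow_left (hlines x hx).2.le 3
      _ = 8 * k ^ 3 := by ring
  have h := hbound A hA N k hN hk2 hNk hfin.toFinset fun y hy =>
    have hy' := hfin.mem_toFinset.1 hy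
    ⟨(hlines y hy').1, (hlines y hy').2.le, (hmult y hy').1⟩
  have hpow : √(A.card : ℝ) ^ 3 = (A.card : ℝ) ^ (3 / 2 : ℝ) := by
    rw [Real.sqrt_eq_rpow, ← Real.rpow_mul_natCast (Nat.cast_nonneg _)]
    norm_num
  rw [← Set.ncard_eq_toFinset_card _ hfin, hpow] at h
  simpa only [Real.sqrt_eq_rpow] using h
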